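/- Let $d\ge 1$, let $A\in GL_d(\mathbb Z)$ have no eigenvalue of modulus $1$, regarded as a linear hyperbolic automorphism of the torus $\mathbb T^d=\mathbb R^d/\mathbb Z^d$, and let $\mu>1$ be the largest modulus of an eigenvalue of $A$. Let $k\ge 2$ be an integer, and for every $b\in\mathbb T^d$ let $f_b:[0,1]\to[0,1]$ be an orientation preserving $C^k$ diffeomorphism with $f_b(0)=0$, $f_b(1)=1$. Suppose that there are constants $C_k,\beta>0$ with $$\|f_b-f_{b'}\|_{C^k[0,1]}\le C_k\|b-b'\|^{\beta}\qquad\text{for all } b,b'\in\mathbb T^d,$$ and that $\lambda_b:=f_b'(0)\le q<1$ for all $b\in\mathbb T^d$. Put $F(b,x)=(Ab,f_b(x))$ on $\mathbb T^d\times[0,1]$ and $F_0(b,x)=(Ab,\lambda_b x)$. Then there are $\varepsilon\in(0,1]$ and a map $H(b,x)=(b,x+h_b(x))$, with $h_b(0)=h_b'(0)=0$, which is defined and continuous on $M_\varepsilon=\mathbb T^d\times[0,\varepsilon]$ and is a homeomorphism of $M_\varepsilon$ onto a neighborhood of $\mathbb T^d\times\{0\}$ in $\mathbb T^d\times[0,1]$,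 such that: 1. $F\circ H=H\circ F_0$ on $M_\varepsilon$; 2. for every $b\in\mathbb T^d$ the function $h_b$ is of class $C^{k-2}$ on $[0,\varepsilon]$; 3. for every $\alpha>0$ with $\alpha\le\beta$ and $\alpha<\log_\mu(1/q)$, and every integer $l$ with $0\le l\le k-2$, there is a constant $\tilde C_l>0$ such that $$\|h_b-h_{b'}\|_{C^l[0,\varepsilon]}\le\tilde C_l\|b-b'\|^{\alpha}\qquad\text{for all } b,b'\in\mathbb T^d.$$ -/

import Mathlib

open Set
open scoped ENNReal

namespace HolderSkew

/-- The linear endomorphism of the torus `ℝ^d / ℤ^d` induced by an integer matrix. -/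
def torusMap {d : ℕ} (A : Matrix (Fin d) (Fin d) ℤ) (b : UnitAddTorus (Fin d)) :
    UnitAddTorus (Fin d) :=
  fun i => ∑ j, A i j • b j

/-- The (complex) eigenvalues of an integer matrix. -/
def eigenvalues {d : ℕ} (A : Matrix (Fin d) (Fin d) ℤ) : Set ℂ :=
  spectrum ℂ (A.map (Int.cast : ℤ → ℂ))

/-- `A` induces a linear hyperbolic automorphism of the torus: it is invertible over `ℤ` and has
no eigenvalue on the unit circle. -/
structure IsHyperbolicAutomorphism {d : ℕ} (A : Matrix (Fin d) (Fin d) ℤ) : Prop where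
  isUnit_det : IsUnit A.det
  norm_ne_one : ∀ z ∈ eigenvalues A, ‖z‖ ≠ 1

/-- `g` restricts to an orientation preserving `C^k` diffeomorphism of `[0,1]` onto itself
(one-sided derivatives at the endpoints). Values of `g` outside `[0,1]` play no role. -/
structure IsOrientedDiffeoUnitInterval (k : ℕ) (g : ℝ → ℝ) : Prop where
  contDiffOn : ContDiffOn ℝ k g (Icc 0 1)
  mapsTo : MapsTo g (Icc 0 1) (Icc 0 1)
  strictMonoOn : StrictMonoOn g (Icc 0 1)
  exists_inverse : ∃ g' : ℝ → ℝ, ContDiffOn ℝ k g' (Icc 0 1) ∧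
    MapsTo g' (Icc 0 1) (Icc 0 1) ∧ InvOn g' g (Icc 0 1) (Icc 0 1)

/-- The `C^l` norm on `[0,r]` (maximum over `j ≤ l` of the sup norm of the `j`-th derivative),
with values in `[0,∞]`. -/
noncomputable def eCNorm (l : ℕ) (r : ℝ) (g : ℝ → ℝ) : ℝ≥0∞ :=
  ⨆ j ∈ Finset.range (l + 1), ⨆ x ∈ Icc (0 : ℝ) r, ‖iteratedDerivWithin j g (Icc 0 r) x‖ₑ

/-- `‖g_b - g_{b'}‖_{C^l[0,r]} ≤ C ‖b - b'‖ ^ α` for all `b, b'` in the torus. -/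
def HolderInBase {d : ℕ} (l : ℕ) (r C α : ℝ) (g : UnitAddTorus (Fin d) → ℝ → ℝ) : Prop :=
  ∀ b b' : UnitAddTorus (Fin d),
    eCNorm l r (fun x => g b x - g b' x) ≤ ENNReal.ofReal (C * ‖b - b'‖ ^ α)

/-- The strip `𝕋^d × [0,r]`. -/
def strip (d : ℕ) (r : ℝ) : Set (UnitAddTorus (Fin d) × ℝ) :=
  univ ×ˢ Icc 0 r

/-- The skew product `(b, x) ↦ (A b, f_b x)`. -/
def skewProduct {d : ℕ} (A : Matrix (Fin d) (Fin d) ℤ) (f : UnitAddTorus (Fin d) → ℝ → ℝ) :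
    UnitAddTorus (Fin d) × ℝ → UnitAddTorus (Fin d) × ℝ :=
  fun p => (torusMap A p.1, f p.1 p.2)

/-- `λ_b = f_b'(0)` (a one-sided derivative, as `f_b` lives on `[0,1]`). -/
noncomputable def multiplier {d : ℕ} (f : UnitAddTorus (Fin d) → ℝ → ℝ)
    (b : UnitAddTorus (Fin d)) : ℝ :=
  derivWithin (f b) (Icc 0 1) 0

/-- The fiberwise linearization `(b, x) ↦ (A b, λ_b x)`. -/
noncomputable def linearization {d : ℕ} (A : Matrix (Fin d) (Fin d) ℤ)
    (f : UnitAddTorus (Fin d) → ℝ → ℝ) :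
    UnitAddTorus (Fin d) × ℝ → UnitAddTorus (Fin d) × ℝ :=
  skewProduct A (fun b x => multiplier f b * x)

/-- The fiber preserving map `(b, x) ↦ (b, x + h_b x)`. -/
def fiberShift {d : ℕ} (h : UnitAddTorus (Fin d) → ℝ → ℝ) :
    UnitAddTorus (Fin d) × ℝ → UnitAddTorus (Fin d) × ℝ :=
  fun p => (p.1, p.2 + h p.1 p.2)

end HolderSkew

open HolderSkew

/-!
For each base point `b` let `lam b` be the derivative of `f b` at `0`. A chart `G b` with
`G (A b) ∘ f b = lam b * G b` and `G b 0 = 0`, `(G b)' 0 = 1` is found through the logarithm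
`Y b = log (G b)'` of its derivative. Differentiating the conjugacy equation gives the
cohomological equation

  `Y b x = log (f b)' x - log (lam b) + Y (A b) (f b x)`,

whose inhomogeneity vanishes at `x = 0`. As the orbits of `f` converge to `0` geometrically, it is
solved by summation along orbits (`cohSol`, `logDerivChart`). Then `G b x = ∫₀ˣ exp (Y b)` (`chart`)
satisfies the conjugacy equation, since both sides vanish at `0` and have the same derivative, and
`H b = (G b)⁻¹` (`invChart`) is the fiber map of the required homeomorphism, `h b x = H b x - x`.

Regularity is tracked by the recursively defined class `SmoothFam ω s l` of families of functions:
the derivatives up to order `l` are bounded, Lipschitz in `x`, and have modulus of continuity `ω`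
in `b`. The formal derivative of a twisted equation `T = v + w * T ∘ F` is the equation
`T' = (v' + w' * T ∘ F) + (w * f') * T' ∘ F` of the same kind, with a more contracting twist, and so
the solution is smooth by induction (`cohSol_smoothFam`). Smoothness of `H` follows from the
differential equation `(H b)' = exp (-Y b ∘ H b)` (`invChart_smoothFam`). The class in use is the one
with `l = k - 2`: the data are functions of `f'`, whose derivatives up to order `k - 2` are Lipschitz.

The Hölder estimates close if `ω` expands along `A` by a factor `M` for which `M` times the
contraction rate is less than `1`. If `Λ` exceeds the spectral radius `μ` of `A`, Gelfand's formula
bounds the expansion of `A ^ n` by a multiple of `Λ ^ n`, and `‖b - b'‖ ^ α` may be replaced by the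
equivalent modulus `sup_n Λ ^ (-n α) * ‖A ^ n b - A ^ n b'‖ ^ α`, which has `M = Λ ^ α`
(`exists_adapted_modulus`). The condition `α < log_μ (1 / q)` says that `μ ^ α * q < 1`. The contraction
rate is close to `q` only on an interval that depends on `α`; since all orbits in a fixed interval
enter it after a bounded number of steps, the estimate carries over to an interval that does not
depend on `α` (`SmoothFam.of_small_interval`, `IsUniformGerm.logDerivChart_smoothFam`).
-/

namespace HolderSkew

open Filter Topology

section

/-! ### Uniformly smooth families of functions -/

/-- The family `v b`, `b ∈ B`, is uniformly bounded on `s`. -/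
def BddFam {B : Type*} (s : Set ℝ) (v : B → ℝ → ℝ) : Prop :=
  ∃ K, 0 ≤ K ∧ ∀ b, ∀ x ∈ s, |v b x| ≤ K

/-- The functions `v b`, `b ∈ B`, are Lipschitz on `s` with a common constant. -/
def LipFam {B : Type*} (s : Set ℝ) (v : B → ℝ → ℝ) : Prop :=
  ∃ K, 0 ≤ K ∧ ∀ b, ∀ x ∈ s, ∀ y ∈ s, |v b x - v b y| ≤ K * |x - y|

/-- The family `v b` depends on the parameter `b` with modulus `ω`, uniformly on `s`. For
`ω b b' = ‖b - b'‖ ^ α` this is `α`-Hölder dependence. -/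
def HolFam {B : Type*} (ω : B → B → ℝ) (s : Set ℝ) (v : B → ℝ → ℝ) : Prop :=
  ∃ K, 0 ≤ K ∧ ∀ b b', ∀ x ∈ s, |v b x - v b' x| ≤ K * ω b b'

/-- Bounded, Lipschitz in the variable and `ω`-Hölder in the parameter. -/
def RegFam {B : Type*} (ω : B → B → ℝ) (s : Set ℝ) (v : B → ℝ → ℝ) : Prop :=
  BddFam s v ∧ LipFam s v ∧ HolFam ω s v

/-- Families all of whose derivatives in the variable up to order `l` (taken within `s`) are bounded,
Lipschitz in the variable and `ω`-Hölder in the parameter. The recursion on `l` turns closure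
properties of this class into inductions that use only the first derivative. -/
def SmoothFam {B : Type*} (ω : B → B → ℝ) (s : Set ℝ) : ℕ → (B → ℝ → ℝ) → Prop
  | 0, v => RegFam ω s v
  | l + 1, v => RegFam ω s v ∧ ∃ v' : B → ℝ → ℝ,
      (∀ b, ∀ x ∈ s, HasDerivWithinAt (v b) (v' b x) s x) ∧ SmoothFam ω s l v'

variable {B : Type*} {ω : B → B → ℝ} {s t : Set ℝ} {l : ℕ} {u v p : B → ℝ → ℝ}

theorem BddFam.mono (hv : BddFam t v) (h : s ⊆ t) : BddFam s v := by
  obtain ⟨K, hK, H⟩ := hv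
  exact ⟨K, hK, fun b x hx => H b x (h hx)⟩

theorem LipFam.mono (hv : LipFam t v) (h : s ⊆ t) : LipFam s v := by
  obtain ⟨K, hK, H⟩ := hv
  exact ⟨K, hK, fun b x hx y hy => H b x (h hx) y (h hy)⟩

theorem HolFam.mono (hv : HolFam ω t v) (h : s ⊆ t) : HolFam ω s v := by
  obtain ⟨K, hK, H⟩ := hv
  exact ⟨K, hK, fun b b' x hx => H b b' x (h hx)⟩

theorem RegFam.mono (hv : RegFam ω t v) (h : s ⊆ t) : RegFam ω s v :=
  ⟨hv.1.mono h, hv.2.1.mono h, hv.2.2.mono h⟩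

theorem SmoothFam.reg (hv : SmoothFam ω s l v) : RegFam ω s v := by
  cases l with
  | zero => exact hv
  | succ l => exact hv.1

theorem SmoothFam.mono (hv : SmoothFam ω t l v) (h : s ⊆ t) : SmoothFam ω s l v := by
  induction l generalizing v with
  | zero => exact RegFam.mono hv h
  | succ l ih =>
    obtain ⟨h0, v', hd, h1⟩ := hv
    exact ⟨h0.mono h, v', fun b x hx => (hd b x (h hx)).mono h, ih h1⟩

theorem SmoothFam.of_succ (hv : SmoothFam ω s (l + 1) v) : SmoothFam ω s l v := by
  induction l generalizing v with
  | zero => exact hv.1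
  | succ l ih =>
    obtain ⟨h0, v', hd, h1⟩ := hv
    exact ⟨h0, v', hd, ih h1⟩

theorem SmoothFam.of_le {m : ℕ} (hv : SmoothFam ω s l v) (h : m ≤ l) : SmoothFam ω s m v := by
  induction l, h using Nat.le_induction with
  | base => exact hv
  | succ l _ ih => exact ih hv.of_succ

theorem RegFam.congr (hv : RegFam ω s v) (h : ∀ b, EqOn (u b) (v b) s) : RegFam ω s u := by
  obtain ⟨⟨K, hK, H⟩, ⟨K1, hK1, H1⟩, ⟨K2, hK2, H2⟩⟩ := hv
  refine ⟨⟨K, hK, fun b x hx => ?_⟩, ⟨K1, hK1, fun b x hx y hy => ?_⟩,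
    ⟨K2, hK2, fun b b' x hx => ?_⟩⟩
  · rw [h b hx]; exact H b x hx
  · rw [h b hx, h b hy]; exact H1 b x hx y hy
  · rw [h b hx, h b' hx]; exact H2 b b' x hx

theorem SmoothFam.congr (hv : SmoothFam ω s l v) (h : ∀ b, EqOn (u b) (v b) s) :
    SmoothFam ω s l u := by
  cases l with
  | zero => exact RegFam.congr hv h
  | succ l =>
    obtain ⟨h0, v', hd, h1⟩ := hv
    exact ⟨h0.congr h, v', fun b x hx => (hd b x hx).congr (h b) (h b hx), h1⟩

theorem BddFam.add (hu : BddFam s u) (hv : BddFam s v) : BddFam s (fun b x => u b x + v b x) := by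
  obtain ⟨K, hK, H⟩ := hu
  obtain ⟨K', hK', H'⟩ := hv
  exact ⟨K + K', by positivity, fun b x hx =>
    (abs_add_le _ _).trans (add_le_add (H b x hx) (H' b x hx))⟩

theorem BddFam.mul (hu : BddFam s u) (hv : BddFam s v) : BddFam s (fun b x => u b x * v b x) := by
  obtain ⟨K, hK, H⟩ := hu
  obtain ⟨K', hK', H'⟩ := hv
  refine ⟨K * K', by positivity, fun b x hx => ?_⟩
  rw [abs_mul]
  exact mul_le_mul (H b x hx) (H' b x hx) (abs_nonneg _) hK

theorem abs_mul_sub_mul_le {a b c d K K' P P' : ℝ} (ha : |a| ≤ K) (hd : |d| ≤ K')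
    (hab : |a - c| ≤ P) (hcd : |b - d| ≤ P') : |a * b - c * d| ≤ K * P' + P * K' := by
  have h : a * b - c * d = a * (b - d) + (a - c) * d := by ring
  rw [h]
  refine (abs_add_le _ _).trans ?_
  rw [abs_mul, abs_mul]
  exact add_le_add (mul_le_mul ha hcd (abs_nonneg _) ((abs_nonneg _).trans ha))
    (mul_le_mul hab hd (abs_nonneg _) ((abs_nonneg _).trans hab))

theorem HolFam.mul (hu : BddFam s u) (hu' : HolFam ω s u) (hv : BddFam s v) (hv' : HolFam ω s v) :
    HolFam ω s (fun b x => u b x * v b x) := by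
  obtain ⟨K, hK, H⟩ := hu
  obtain ⟨K', hK', H'⟩ := hv
  obtain ⟨P, hP, I⟩ := hu'
  obtain ⟨P', hP', I'⟩ := hv'
  refine ⟨K * P' + P * K', by positivity, fun b b' x hx => ?_⟩
  refine (abs_mul_sub_mul_le (H b x hx) (H' b' x hx) (I b b' x hx) (I' b b' x hx)).trans
    (le_of_eq (by ring))

theorem RegFam.mul (hu : RegFam ω s u) (hv : RegFam ω s v) :
    RegFam ω s (fun b x => u b x * v b x) := by
  refine ⟨hu.1.mul hv.1, ?_, HolFam.mul hu.1 hu.2.2 hv.1 hv.2.2⟩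
  obtain ⟨⟨K, hK, H⟩, ⟨P, hP, I⟩, -⟩ := hu
  obtain ⟨⟨K', hK', H'⟩, ⟨P', hP', I'⟩, -⟩ := hv
  refine ⟨K * P' + P * K', by positivity, fun b x hx y hy => ?_⟩
  refine (abs_mul_sub_mul_le (H b x hx) (H' b y hy) (I b x hx y hy) (I' b x hx y hy)).trans
    (le_of_eq (by ring))

theorem RegFam.add (hu : RegFam ω s u) (hv : RegFam ω s v) :
    RegFam ω s (fun b x => u b x + v b x) := by
  refine ⟨hu.1.add hv.1, ?_, ?_⟩
  · obtain ⟨-, ⟨P, hP, I⟩, -⟩ := hu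
    obtain ⟨-, ⟨P', hP', I'⟩, -⟩ := hv
    refine ⟨P + P', by positivity, fun b x hx y hy => ?_⟩
    rw [add_sub_add_comm, add_mul]
    exact (abs_add_le _ _).trans (add_le_add (I b x hx y hy) (I' b x hx y hy))
  · obtain ⟨-, -, ⟨P, hP, I⟩⟩ := hu
    obtain ⟨-, -, ⟨P', hP', I'⟩⟩ := hv
    refine ⟨P + P', by positivity, fun b b' x hx => ?_⟩
    rw [add_sub_add_comm, add_mul]
    exact (abs_add_le _ _).trans (add_le_add (I b b' x hx) (I' b b' x hx))

theorem SmoothFam.add (hu : SmoothFam ω s l u) (hv : SmoothFam ω s l v) :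
    SmoothFam ω s l (fun b x => u b x + v b x) := by
  induction l generalizing u v with
  | zero => exact RegFam.add hu hv
  | succ l ih =>
    obtain ⟨hu0, u', hud, hu'⟩ := hu
    obtain ⟨hv0, v', hvd, hv'⟩ := hv
    exact ⟨hu0.add hv0, _, fun b x hx => (hud b x hx).add (hvd b x hx), ih hu' hv'⟩

theorem SmoothFam.mul (hu : SmoothFam ω s l u) (hv : SmoothFam ω s l v) :
    SmoothFam ω s l (fun b x => u b x * v b x) := by
  induction l generalizing u v with
  | zero => exact RegFam.mul hu hv
  | succ l ih =>
    have hu1 := hu.of_succ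
    have hv1 := hv.of_succ
    obtain ⟨hu0, u', hud, hu'⟩ := hu
    obtain ⟨hv0, v', hvd, hv'⟩ := hv
    exact ⟨hu0.mul hv0, _, fun b x hx => (hud b x hx).mul (hvd b x hx),
      (ih hu' hv1).add (ih hu1 hv')⟩

theorem smoothFam_const (c : ℝ) :
    SmoothFam ω s l (fun (_ : B) _ => c) := by
  have h0 (c : ℝ) : RegFam ω s (fun (_ : B) _ => c) := by
    refine ⟨⟨|c|, abs_nonneg c, fun _ _ _ => le_rfl⟩, ⟨0, le_rfl, ?_⟩, ⟨0, le_rfl, ?_⟩⟩ <;> simp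
  induction l generalizing c with
  | zero => exact h0 c
  | succ l ih => exact ⟨h0 c, _, fun b x hx => hasDerivWithinAt_const x s c, ih 0⟩

theorem smoothFam_id (hs : ∃ K, ∀ x ∈ s, |x| ≤ K) :
    SmoothFam ω s l (fun (_ : B) x => x) := by
  have h0 : RegFam ω s (fun (_ : B) x => x) := by
    obtain ⟨K, hK⟩ := hs
    refine ⟨⟨max K 0, le_max_right _ _, fun _ x hx => (hK x hx).trans (le_max_left _ _)⟩,
      ⟨1, zero_le_one, ?_⟩, ⟨0, le_rfl, ?_⟩⟩ <;> simp
  cases l with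
  | zero => exact h0
  | succ l => exact ⟨h0, _, fun b x hx => hasDerivWithinAt_id x s, smoothFam_const 1⟩

theorem SmoothFam.neg (hv : SmoothFam ω s l v) :
    SmoothFam ω s l (fun b x => - v b x) :=
  ((smoothFam_const (-1)).mul hv).congr fun b x _ => by simp

theorem SmoothFam.sub (hu : SmoothFam ω s l u)
    (hv : SmoothFam ω s l v) : SmoothFam ω s l (fun b x => u b x - v b x) :=
  (hu.add (hv.neg)).congr fun b x _ => by simp [sub_eq_add_neg]

theorem SmoothFam.reindex {M : ℝ} {A : B → B} (hM : 0 ≤ M)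
    (hA : ∀ b b', ω (A b) (A b') ≤ M * ω b b') (hv : SmoothFam ω s l v) :
    SmoothFam ω s l (fun b => v (A b)) := by
  have h0 {v : B → ℝ → ℝ} (hv : RegFam ω s v) : RegFam ω s (fun b => v (A b)) := by
    obtain ⟨⟨K, hK, H⟩, ⟨P, hP, I⟩, ⟨Q, hQ, J⟩⟩ := hv
    refine ⟨⟨K, hK, fun b => H (A b)⟩, ⟨P, hP, fun b => I (A b)⟩,
      ⟨Q * M, by positivity, fun b b' x hx => (J _ _ x hx).trans ?_⟩⟩
    rw [mul_assoc]
    exact mul_le_mul_of_nonneg_left (hA b b') hQ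
  induction l generalizing v with
  | zero => exact h0 hv
  | succ l ih =>
    obtain ⟨hv0, v', hvd, hv'⟩ := hv
    exact ⟨h0 hv0, _, fun b x hx => hvd (A b) x hx, ih hv'⟩

theorem SmoothFam.comp (hv : SmoothFam ω t l v) (hp : SmoothFam ω s l p)
    (hm : ∀ b, MapsTo (p b) s t) : SmoothFam ω s l (fun b x => v b (p b x)) := by
  have h0 {v : B → ℝ → ℝ} (hv : RegFam ω t v) (hp : RegFam ω s p) :
      RegFam ω s (fun b x => v b (p b x)) := by
    obtain ⟨⟨K, hK, H⟩, ⟨P, hP, I⟩, ⟨Q, hQ, J⟩⟩ := hv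
    obtain ⟨-, ⟨P', hP', I'⟩, ⟨Q', hQ', J'⟩⟩ := hp
    refine ⟨⟨K, hK, fun b x hx => H b _ (hm b hx)⟩, ⟨P * P', by positivity,
      fun b x hx y hy => ?_⟩, ⟨P * Q' + Q, by positivity, fun b b' x hx => ?_⟩⟩
    · refine (I b _ (hm b hx) _ (hm b hy)).trans ?_
      rw [mul_assoc]
      exact mul_le_mul_of_nonneg_left (I' b x hx y hy) hP
    · refine (abs_sub_le _ (v b (p b' x)) _).trans ?_
      rw [add_mul, mul_assoc]
      exact add_le_add ((I b _ (hm b hx) _ (hm b' hx)).trans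
        (mul_le_mul_of_nonneg_left (J' b b' x hx) hP)) (J b b' _ (hm b' hx))
  induction l generalizing v with
  | zero => exact h0 hv hp
  | succ l ih =>
    have hp1 := hp.of_succ
    obtain ⟨hv0, v', hvd, hv'⟩ := hv
    obtain ⟨hp0, p', hpd, hp'⟩ := hp
    exact ⟨h0 hv0 hp0, _, fun b x hx => (hvd b _ (hm b hx)).comp x (hpd b x hx) (hm b),
      (ih hv' hp1).mul hp'⟩

theorem RegFam.scalar_comp {φ : ℝ → ℝ} {K K' : ℝ} (hK : 0 ≤ K) (hK' : 0 ≤ K')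
    (hφ : ∀ a ∈ t, ∀ c ∈ t, |φ a - φ c| ≤ K * |a - c|) (hφ' : ∀ a ∈ t, |φ a| ≤ K')
    (hv : RegFam ω s v) (hm : ∀ b, MapsTo (v b) s t) : RegFam ω s (fun b x => φ (v b x)) := by
  obtain ⟨-, ⟨P, hP, I⟩, ⟨Q, hQ, J⟩⟩ := hv
  refine ⟨⟨K', hK', fun b x hx => hφ' _ (hm b hx)⟩, ⟨K * P, by positivity, fun b x hx y hy => ?_⟩,
    ⟨K * Q, by positivity, fun b b' x hx => ?_⟩⟩
  · refine (hφ _ (hm b hx) _ (hm b hy)).trans ?_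
    rw [mul_assoc]
    exact mul_le_mul_of_nonneg_left (I b x hx y hy) hK
  · refine (hφ _ (hm b hx) _ (hm b' hx)).trans ?_
    rw [mul_assoc]
    exact mul_le_mul_of_nonneg_left (J b b' x hx) hK

theorem SmoothFam.exp (hv : SmoothFam ω s l v) :
    SmoothFam ω s l (fun b x => Real.exp (v b x)) := by
  have h0 {v : B → ℝ → ℝ} (hv : RegFam ω s v) : RegFam ω s (fun b x => Real.exp (v b x)) := by
    obtain ⟨K, hK, H⟩ := hv.1
    refine RegFam.scalar_comp (t := Iic K) (K := Real.exp K) (K' := Real.exp K)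
      (Real.exp_pos K).le (Real.exp_pos K).le (fun a ha c hc => ?_) (fun a ha => ?_) hv
      fun b x hx => (le_abs_self _).trans (H b x hx)
    · exact (convex_Iic K).norm_image_sub_le_of_norm_hasDerivWithin_le
        (fun x _ => (Real.hasDerivAt_exp x).hasDerivWithinAt)
        (fun x hx => by rw [Real.norm_eq_abs, Real.abs_exp]; exact Real.exp_le_exp.2 hx) hc ha
    · rw [Real.abs_exp]; exact Real.exp_le_exp.2 ha
  induction l generalizing v with
  | zero => exact h0 hv
  | succ l ih =>
    have hv1 := hv.of_succ
    obtain ⟨hv0, v', hvd, hv'⟩ := hv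
    exact ⟨h0 hv0, _, fun b x hx => (hvd b x hx).exp, (ih hv1).mul hv'⟩

theorem SmoothFam.log {c : ℝ} (hc : 0 < c) (hvc : ∀ b, ∀ x ∈ s, c ≤ v b x)
    (hv : SmoothFam ω s l v) : SmoothFam ω s l (fun b x => Real.log (v b x)) := by
  have h0 (hv : RegFam ω s v) : RegFam ω s (fun b x => Real.log (v b x)) := by
    obtain ⟨K, hK, H⟩ := hv.1
    have hlip : ∀ a ∈ Ici c, ∀ d ∈ Ici c, |Real.log a - Real.log d| ≤ c⁻¹ * |a - d| := by
      intro a ha d hd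
      refine (convex_Ici c).norm_image_sub_le_of_norm_hasDerivWithin_le
        (fun x hx => (Real.hasDerivAt_log (hc.trans_le hx).ne').hasDerivWithinAt)
        (fun x hx => ?_) hd ha
      rw [norm_inv, Real.norm_eq_abs, abs_of_pos (hc.trans_le hx)]
      exact inv_anti₀ hc hx
    refine RegFam.scalar_comp (t := Icc c K) (K := c⁻¹) (K' := c⁻¹ * (K + c) + |Real.log c|)
      (by positivity) (by positivity) (fun a ha d hd => hlip a ha.1 d hd.1) (fun a ha => ?_) hv
      fun b x hx => ⟨hvc b x hx, (le_abs_self _).trans (H b x hx)⟩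
    have h1 : |Real.log a| ≤ |Real.log a - Real.log c| + |Real.log c| := by
      simpa using abs_add_le (Real.log a - Real.log c) (Real.log c)
    refine h1.trans (add_le_add_left ((hlip a ha.1 c (mem_Ici.2 le_rfl)).trans ?_) _)
    refine mul_le_mul_of_nonneg_left ?_ (by positivity)
    rw [abs_of_nonneg (sub_nonneg.2 ha.1)]
    linarith [ha.2]
  induction l with
  | zero => exact h0 hv
  | succ l ih =>
    have hv1 := ih hv.of_succ
    obtain ⟨hv0, v', hvd, hv'⟩ := hv
    -- the reciprocal is `1 / v = exp (-log v)`, which is in the class by the induction hypothesis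
    refine ⟨h0 hv0, _, fun b x hx => ?_, hv'.mul (hv1.neg).exp⟩
    have hpos := hc.trans_le (hvc b x hx)
    simpa [Real.exp_neg, Real.exp_log hpos, div_eq_mul_inv] using (hvd b x hx).log hpos.ne'

theorem SmoothFam.contDiffOn {r : ℝ} (hr : 0 < r) (hv : SmoothFam ω (Icc 0 r) l v) (b : B) :
    ContDiffOn ℝ l (v b) (Icc 0 r) := by
  induction l generalizing v with
  | zero =>
    obtain ⟨-, ⟨K, hK, H⟩, -⟩ := hv
    simp only [Nat.cast_zero, contDiffOn_zero]
    refine LipschitzOnWith.continuousOn (K := ⟨K, hK⟩) ?_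
    exact LipschitzOnWith.of_dist_le_mul fun x hx y hy => H b x hx y hy
  | succ l ih =>
    obtain ⟨-, v', hvd, hv'⟩ := hv
    rw [Nat.cast_succ, contDiffOn_succ_iff_derivWithin (uniqueDiffOn_Icc hr)]
    refine ⟨fun x hx => (hvd b x hx).differentiableWithinAt, by simp, (ih hv').congr fun x hx => ?_⟩
    exact (hvd b x hx).derivWithin (uniqueDiffOn_Icc hr x hx)

/-- A smooth family depends on the parameter with modulus `ω` in the `C^l` norm. -/
theorem SmoothFam.eCNorm_sub_le (hω : ∀ b b', 0 ≤ ω b b') {r : ℝ} (hr : 0 < r)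
    (hv : SmoothFam ω (Icc 0 r) l v) :
    ∃ K, 0 ≤ K ∧ ∀ b b', eCNorm l r (fun x => v b x - v b' x) ≤ ENNReal.ofReal (K * ω b b') := by
  have key : ∀ l (v : B → ℝ → ℝ), SmoothFam ω (Icc 0 r) l v → ∃ K, 0 ≤ K ∧ ∀ b b', ∀ j ≤ l,
      ∀ x ∈ Icc 0 r, |iteratedDerivWithin j (fun x => v b x - v b' x) (Icc 0 r) x| ≤ K * ω b b' := by
    intro l
    induction l with
    | zero =>
      rintro v ⟨-, -, K, hK, H⟩
      refine ⟨K, hK, fun b b' j hj x hx => ?_⟩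
      obtain rfl : j = 0 := by omega
      simpa using H b b' x hx
    | succ l ih =>
      rintro v ⟨⟨-, -, K, hK, H⟩, v', hvd, hv'⟩
      obtain ⟨K', hK', H'⟩ := ih v' hv'
      refine ⟨max K K', hK.trans (le_max_left _ _), fun b b' j hj x hx => ?_⟩
      cases j with
      | zero =>
        simpa using (H b b' x hx).trans
          (mul_le_mul_of_nonneg_right (le_max_left _ _) (hω b b'))
      | succ j =>
        rw [iteratedDerivWithin_succ']
        have hcongr : EqOn (derivWithin (fun x => v b x - v b' x) (Icc 0 r))
            (fun x => v' b x - v' b' x) (Icc 0 r) := fun y hy =>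
          ((hvd b y hy).sub (hvd b' y hy)).derivWithin (uniqueDiffOn_Icc hr y hy)
        rw [iteratedDerivWithin_congr hcongr hx]
        exact (H' b b' j (by omega) x hx).trans
          (mul_le_mul_of_nonneg_right (le_max_right _ _) (hω b b'))
  obtain ⟨K, hK, H⟩ := key l v hv
  refine ⟨K, hK, fun b b' => ?_⟩
  refine iSup₂_le fun j hj => iSup₂_le fun x hx => ?_
  rw [← ofReal_norm]
  exact ENNReal.ofReal_le_ofReal (H b b' j (by simpa [Nat.lt_succ_iff] using hj) x hx)

end

section

/-! ### Cohomological equations over a fiberwise contraction -/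

/-- Termwise differentiation within a convex set, which may contain endpoints. -/
theorem hasDerivWithinAt_of_uniform_limit {s : Set ℝ} (hs : Convex ℝ s) {F F' : ℕ → ℝ → ℝ}
    {g g' : ℝ → ℝ} {c : ℕ → ℝ} (hF : ∀ n, ∀ x ∈ s, HasDerivWithinAt (F n) (F' n x) s x)
    (hlim : ∀ x ∈ s, Tendsto (fun n => F n x) atTop (𝓝 (g x))) (hc : Tendsto c atTop (𝓝 0))
    (hunif : ∀ n, ∀ x ∈ s, |F' n x - g' x| ≤ c n) {x : ℝ} (hx : x ∈ s) :
    HasDerivWithinAt g (g' x) s x := by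
  have key : ∀ n, ∀ y ∈ s, |(F n y - g y) - (F n x - g x)| ≤ c n * |y - x| := by
    intro n y hy
    have h1 : ∀ m, |(F n y - F m y) - (F n x - F m x)| ≤ (c n + c m) * |y - x| := fun m =>
      hs.norm_image_sub_le_of_norm_hasDerivWithin_le (f := fun z => F n z - F m z)
        (fun z hz => (hF n z hz).sub (hF m z hz))
        (fun z hz => by
          have h2 : F' n z - F' m z = (F' n z - g' z) - (F' m z - g' z) := by ring
          rw [h2]
          exact (norm_sub_le _ _).trans (add_le_add (hunif n z hz) (hunif m z hz))) hx hy
    have h2 : Tendsto (fun m => |(F n y - F m y) - (F n x - F m x)|) atTop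
        (𝓝 |(F n y - g y) - (F n x - g x)|) :=
      ((tendsto_const_nhds.sub (hlim y hy)).sub (tendsto_const_nhds.sub (hlim x hx))).abs
    have h3 : Tendsto (fun m => (c n + c m) * |y - x|) atTop (𝓝 ((c n + 0) * |y - x|)) :=
      (tendsto_const_nhds.add hc).mul_const _
    simpa using le_of_tendsto_of_tendsto' h2 h3 h1
  rw [hasDerivWithinAt_iff_isLittleO, Asymptotics.isLittleO_iff]
  intro e he
  obtain ⟨n, hn⟩ := (hc.eventually (gt_mem_nhds (show (0 : ℝ) < e / 4 by positivity))).exists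
  have h1 := hasDerivWithinAt_iff_isLittleO.1 (hF n x hx)
  rw [Asymptotics.isLittleO_iff] at h1
  filter_upwards [h1 (show (0 : ℝ) < e / 2 by positivity), self_mem_nhdsWithin] with y hy hys
  have h2 := key n y hys
  have h3 : |y - x| * |F' n x - g' x| ≤ |y - x| * c n :=
    mul_le_mul_of_nonneg_left (hunif n x hx) (abs_nonneg _)
  have h4 : g y - g x - (y - x) • g' x = (F n y - F n x - (y - x) • F' n x)
      - ((F n y - g y) - (F n x - g x)) + (y - x) * (F' n x - g' x) := by
    simp only [smul_eq_mul]; ring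
  have h5 : |y - x| * c n ≤ |y - x| * (e / 4) := mul_le_mul_of_nonneg_left hn.le (abs_nonneg _)
  rw [h4]
  refine (norm_add_le _ _).trans ((add_le_add_left (norm_sub_le _ _) _).trans ?_)
  simp only [Real.norm_eq_abs, abs_mul] at hy ⊢
  nlinarith

/-- The approximations, started from `0`, to a solution of the twisted cohomological equation
`T b x = v b x + w b x * T (A b) (f b x)`. -/
def cohIter {B : Type*} (A : B → B) (f v w : B → ℝ → ℝ) : ℕ → B → ℝ → ℝ
  | 0 => fun _ _ => 0
  | n + 1 => fun b x => v b x + w b x * cohIter A f v w n (A b) (f b x)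

/-- The solution `T b x = ∑ₙ (∏ i < n, w bᵢ xᵢ) * v bₙ xₙ`, with `(bᵢ, xᵢ)` the orbit of `(b, x)`,
of the twisted cohomological equation `T b x = v b x + w b x * T (A b) (f b x)`. It involves no
modulus of continuity, so one and the same function can be examined with different moduli. -/
noncomputable def cohSol {B : Type*} (A : B → B) (f v w : B → ℝ → ℝ) (b : B) (x : ℝ) : ℝ :=
  limUnder atTop fun n => cohIter A f v w n b x

/-- The skew product `(b, x) ↦ (A b, f b x)` contracts the fibers `[0,r]` at a rate `κ` that beats
the expansion `M` of the modulus `ω` under `A`; `f'` is the fiber derivative. -/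
structure IsFiberContraction {B : Type*} (A : B → B) (ω : B → B → ℝ) (r κ M : ℝ)
    (f f' : B → ℝ → ℝ) : Prop where
  pos : 0 < r
  le_one : r ≤ 1
  modulus_nonneg : ∀ b b', 0 ≤ ω b b'
  modulus_le : ∀ b b', ω (A b) (A b') ≤ M * ω b b'
  rate_nonneg : 0 ≤ κ
  rate_lt_one : κ < 1
  expansion_nonneg : 0 ≤ M
  expansion_mul_rate_lt_one : M * κ < 1
  map_nonneg : ∀ b, ∀ x ∈ Icc 0 r, 0 ≤ f b x
  map_le : ∀ b, ∀ x ∈ Icc 0 r, f b x ≤ κ * x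
  hasDeriv : ∀ b, ∀ x ∈ Icc 0 r, HasDerivWithinAt (f b) (f' b x) (Icc 0 r) x
  deriv_le : ∀ b, ∀ x ∈ Icc 0 r, |f' b x| ≤ κ
  holder : ∃ K, 0 ≤ K ∧ ∀ b b', ∀ x ∈ Icc 0 r, |f b x - f b' x| ≤ K * ω b b' * x

/-- Data for a solvable twisted equation: a weight `ϖ` with `x ≤ ϖ x ≤ 1`, not increasing along
orbits, such that `w` contracts it and `v` is `O(ϖ)` with Hölder dependence of the same order. The
two weights in use are `ϖ x = x` (for `w = 1` and `v b 0 = 0`) and `ϖ = 1` (for `|w| ≤ κ`). -/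
structure IsCohData {B : Type*} (ω : B → B → ℝ) (r κ : ℝ) (f : B → ℝ → ℝ) (ϖ : ℝ → ℝ)
    (v w : B → ℝ → ℝ) : Prop where
  self_le : ∀ x ∈ Icc 0 r, x ≤ ϖ x
  le_one : ∀ x ∈ Icc 0 r, ϖ x ≤ 1
  map_le : ∀ b, ∀ x ∈ Icc 0 r, ϖ (f b x) ≤ ϖ x
  twist_le_one : ∀ b, ∀ x ∈ Icc 0 r, |w b x| ≤ 1
  twist_mul_le : ∀ b, ∀ x ∈ Icc 0 r, |w b x| * ϖ (f b x) ≤ κ * ϖ x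
  bdd : ∃ K, 0 ≤ K ∧ ∀ b, ∀ x ∈ Icc 0 r, |v b x| ≤ K * ϖ x
  lip : LipFam (Icc 0 r) v
  hol : ∃ K, 0 ≤ K ∧ ∀ b b', ∀ x ∈ Icc 0 r, |v b x - v b' x| ≤ K * ω b b' * ϖ x
  twist_lip : LipFam (Icc 0 r) w
  twist_hol : HolFam ω (Icc 0 r) w

variable {B : Type*} {A : B → B} {ω : B → B → ℝ} {r κ M : ℝ} {f f' v w v' w' : B → ℝ → ℝ}
  {ϖ : ℝ → ℝ} {l : ℕ}

theorem IsFiberContraction.mapsTo (hf : IsFiberContraction A ω r κ M f f') (b : B) :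
    MapsTo (f b) (Icc 0 r) (Icc 0 r) := fun x hx =>
  ⟨hf.map_nonneg b x hx, (hf.map_le b x hx).trans
    ((mul_le_of_le_one_left hx.1 hf.rate_lt_one.le).trans hx.2)⟩

theorem IsFiberContraction.lipschitz (hf : IsFiberContraction A ω r κ M f f') (b : B) {x y : ℝ}
    (hx : x ∈ Icc 0 r) (hy : y ∈ Icc 0 r) : |f b x - f b y| ≤ κ * |x - y| :=
  (convex_Icc 0 r).norm_image_sub_le_of_norm_hasDerivWithin_le (hf.hasDeriv b) (hf.deriv_le b) hy hx

theorem IsFiberContraction.regFam (hf : IsFiberContraction A ω r κ M f f') :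
    RegFam ω (Icc 0 r) f := by
  refine ⟨⟨r, hf.pos.le, fun b x hx => ?_⟩, ⟨κ, hf.rate_nonneg, fun b x hx y hy =>
    hf.lipschitz b hx hy⟩, ?_⟩
  · rw [abs_of_nonneg (hf.map_nonneg b x hx)]
    exact (hf.mapsTo b hx).2
  · obtain ⟨K, hK, H⟩ := hf.holder
    refine ⟨K, hK, fun b b' x hx => (H b b' x hx).trans ?_⟩
    exact mul_le_of_le_one_right (mul_nonneg hK (hf.modulus_nonneg b b'))
      (hx.2.trans hf.le_one)

theorem cohIter_bdd (hf : IsFiberContraction A ω r κ M f f') (hd : IsCohData ω r κ f ϖ v w) :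
    ∃ D, 0 ≤ D ∧ ∀ n b, ∀ x ∈ Icc 0 r, |cohIter A f v w n b x| ≤ D * ϖ x := by
  obtain ⟨K, hK, H⟩ := hd.bdd
  have hκ : 0 < 1 - κ := by linarith [hf.rate_lt_one]
  have hD : 0 ≤ K / (1 - κ) := by positivity
  have hDeq : K + κ * (K / (1 - κ)) = K / (1 - κ) := by field_simp; ring
  refine ⟨K / (1 - κ), hD, fun n => ?_⟩
  induction n with
  | zero =>
    intro b x hx
    simpa [cohIter] using mul_nonneg hD (hx.1.trans (hd.self_le x hx))
  | succ n ih =>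
    intro b x hx
    have h1 := H b x hx
    have h2 : |w b x * cohIter A f v w n (A b) (f b x)| ≤ K / (1 - κ) * (κ * ϖ x) := by
      rw [abs_mul]
      calc |w b x| * |cohIter A f v w n (A b) (f b x)|
          ≤ |w b x| * (K / (1 - κ) * ϖ (f b x)) :=
            mul_le_mul_of_nonneg_left (ih _ _ (hf.mapsTo b hx)) (abs_nonneg _)
        _ = K / (1 - κ) * (|w b x| * ϖ (f b x)) := by ring
        _ ≤ _ := mul_le_mul_of_nonneg_left (hd.twist_mul_le b x hx) hD
    refine (abs_add_le _ _).trans ((add_le_add h1 h2).trans (le_of_eq ?_))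
    rw [← mul_assoc, ← add_mul, mul_comm (K / (1 - κ)) κ, hDeq]

theorem cohIter_lip (hf : IsFiberContraction A ω r κ M f f') (hd : IsCohData ω r κ f ϖ v w) :
    ∃ P, 0 ≤ P ∧ ∀ n b, ∀ x ∈ Icc 0 r, ∀ y ∈ Icc 0 r,
      |cohIter A f v w n b x - cohIter A f v w n b y| ≤ P * |x - y| := by
  obtain ⟨D, hD, HD⟩ := cohIter_bdd hf hd
  obtain ⟨K, hK, H⟩ := hd.lip
  obtain ⟨Q, hQ, I⟩ := hd.twist_lip
  have hκ : 0 < 1 - κ := by linarith [hf.rate_lt_one]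
  set P := (K + Q * D) / (1 - κ) with hPdef
  have hP : 0 ≤ P := by positivity
  have hPeq : K + Q * D + κ * P = P := by rw [hPdef]; field_simp; ring
  refine ⟨P, hP, fun n => ?_⟩
  induction n with
  | zero =>
    intro b x hx y hy
    simpa [cohIter] using mul_nonneg hP (abs_nonneg (x - y))
  | succ n ih =>
    intro b x hx y hy
    have h2 := abs_mul_sub_mul_le (hd.twist_le_one b x hx)
      ((HD n (A b) (f b y) (hf.mapsTo b hy)).trans
        (mul_le_of_le_one_right hD (hd.le_one _ (hf.mapsTo b hy)))) (I b x hx y hy)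
      ((ih (A b) _ (hf.mapsTo b hx) _ (hf.mapsTo b hy)).trans
        (mul_le_mul_of_nonneg_left (hf.lipschitz b hx hy) hP))
    simp only [cohIter]
    rw [add_sub_add_comm]
    refine (abs_add_le _ _).trans ((add_le_add (H b x hx y hy) h2).trans (le_of_eq ?_))
    nth_rewrite 2 [← hPeq]
    ring

theorem cohIter_hol (hf : IsFiberContraction A ω r κ M f f') (hd : IsCohData ω r κ f ϖ v w) :
    ∃ E, 0 ≤ E ∧ ∀ n b b', ∀ x ∈ Icc 0 r,
      |cohIter A f v w n b x - cohIter A f v w n b' x| ≤ E * ω b b' * ϖ x := by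
  obtain ⟨D, hD, HD⟩ := cohIter_bdd hf hd
  obtain ⟨P, hP, HP⟩ := cohIter_lip hf hd
  obtain ⟨K, hK, H⟩ := hd.hol
  obtain ⟨Q, hQ, I⟩ := hd.twist_hol
  obtain ⟨R, hR, J⟩ := hf.holder
  have hκ : 0 < 1 - M * κ := by linarith [hf.expansion_mul_rate_lt_one]
  set E := (K + Q * D + P * R) / (1 - M * κ) with hEdef
  have hE : 0 ≤ E := by positivity
  have hEeq : K + Q * D + P * R + M * κ * E = E := by rw [hEdef]; field_simp; ring
  refine ⟨E, hE, fun n => ?_⟩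
  induction n with
  | zero =>
    intro b b' x hx
    simpa [cohIter] using mul_nonneg (mul_nonneg hE (hf.modulus_nonneg b b'))
      (hx.1.trans (hd.self_le x hx))
  | succ n ih =>
    intro b b' x hx
    have hω := hf.modulus_nonneg b b'
    have hϖ := hx.1.trans (hd.self_le x hx)
    have h1 := H b b' x hx
    have h2 : |(w b x - w b' x) * cohIter A f v w n (A b) (f b x)| ≤ Q * D * ω b b' * ϖ x := by
      rw [abs_mul]
      refine (mul_le_mul (I b b' x hx) ((HD n _ _ (hf.mapsTo b hx)).trans
        (mul_le_mul_of_nonneg_left (hd.map_le b x hx) hD)) (abs_nonneg _)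
        (mul_nonneg hQ hω)).trans (le_of_eq (by ring))
    have h3 : |w b' x * (cohIter A f v w n (A b) (f b x) - cohIter A f v w n (A b) (f b' x))|
        ≤ P * R * ω b b' * ϖ x := by
      rw [abs_mul]
      refine (mul_le_of_le_one_left (abs_nonneg _) (hd.twist_le_one b' x hx)).trans ?_
      refine (HP n (A b) _ (hf.mapsTo b hx) _ (hf.mapsTo b' hx)).trans ?_
      rw [mul_assoc P, mul_assoc P]
      exact mul_le_mul_of_nonneg_left ((J b b' x hx).trans
        (mul_le_mul_of_nonneg_left (hd.self_le x hx) (mul_nonneg hR hω))) hP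
    have h4 : |w b' x * (cohIter A f v w n (A b) (f b' x) - cohIter A f v w n (A b') (f b' x))|
        ≤ M * κ * E * ω b b' * ϖ x := by
      rw [abs_mul]
      calc _ ≤ |w b' x| * (E * (M * ω b b') * ϖ (f b' x)) := by
            refine mul_le_mul_of_nonneg_left ((ih _ _ _ (hf.mapsTo b' hx)).trans ?_) (abs_nonneg _)
            have h5 := (hf.mapsTo b' hx).1.trans (hd.self_le _ (hf.mapsTo b' hx))
            exact mul_le_mul_of_nonneg_right
              (mul_le_mul_of_nonneg_left (hf.modulus_le b b') hE) h5
        _ = E * (M * ω b b') * (|w b' x| * ϖ (f b' x)) := by ring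
        _ ≤ E * (M * ω b b') * (κ * ϖ x) :=
            mul_le_mul_of_nonneg_left (hd.twist_mul_le b' x hx)
              (mul_nonneg hE (mul_nonneg hf.expansion_nonneg hω))
        _ = _ := by ring
    have h5 : cohIter A f v w (n + 1) b x - cohIter A f v w (n + 1) b' x
        = (v b x - v b' x) + (w b x - w b' x) * cohIter A f v w n (A b) (f b x)
          + w b' x * (cohIter A f v w n (A b) (f b x) - cohIter A f v w n (A b) (f b' x))
          + w b' x * (cohIter A f v w n (A b) (f b' x) - cohIter A f v w n (A b') (f b' x)) := by
      simp only [cohIter]; ring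
    rw [h5]
    refine (abs_add_le _ _).trans ((add_le_add ((abs_add_le _ _).trans (add_le_add
      ((abs_add_le _ _).trans (add_le_add h1 h2)) h3)) h4).trans (le_of_eq ?_))
    nth_rewrite 2 [← hEeq]
    ring

theorem cohIter_succ_sub_le (hf : IsFiberContraction A ω r κ M f f')
    (hd : IsCohData ω r κ f ϖ v w) :
    ∃ K, 0 ≤ K ∧ ∀ n b, ∀ x ∈ Icc 0 r,
      |cohIter A f v w n b x - cohIter A f v w (n + 1) b x| ≤ K * κ ^ n * ϖ x := by
  obtain ⟨K, hK, H⟩ := hd.bdd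
  refine ⟨K, hK, fun n => ?_⟩
  induction n with
  | zero => intro b x hx; simpa [cohIter] using H b x hx
  | succ n ih =>
    intro b x hx
    have h1 : cohIter A f v w (n + 1) b x - cohIter A f v w (n + 1 + 1) b x = w b x *
        (cohIter A f v w n (A b) (f b x) - cohIter A f v w (n + 1) (A b) (f b x)) := by
      simp only [cohIter]; ring
    rw [h1, abs_mul]
    calc _ ≤ |w b x| * (K * κ ^ n * ϖ (f b x)) :=
          mul_le_mul_of_nonneg_left (ih _ _ (hf.mapsTo b hx)) (abs_nonneg _)
      _ = K * κ ^ n * (|w b x| * ϖ (f b x)) := by ring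
      _ ≤ K * κ ^ n * (κ * ϖ x) := mul_le_mul_of_nonneg_left (hd.twist_mul_le b x hx)
          (mul_nonneg hK (pow_nonneg hf.rate_nonneg n))
      _ = _ := by ring

theorem tendsto_cohIter (hf : IsFiberContraction A ω r κ M f f') (hd : IsCohData ω r κ f ϖ v w)
    (b : B) {x : ℝ} (hx : x ∈ Icc 0 r) :
    Tendsto (fun n => cohIter A f v w n b x) atTop (𝓝 (cohSol A f v w b x)) := by
  obtain ⟨K, hK, H⟩ := cohIter_succ_sub_le hf hd
  refine (cauchySeq_of_le_geometric κ (K * ϖ x) hf.rate_lt_one fun n => ?_).tendsto_limUnder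
  rw [Real.dist_eq]
  exact (H n b x hx).trans (le_of_eq (by ring))

theorem cohIter_sub_cohSol_le (hf : IsFiberContraction A ω r κ M f f')
    (hd : IsCohData ω r κ f ϖ v w) :
    ∃ K, 0 ≤ K ∧ ∀ n b, ∀ x ∈ Icc 0 r,
      |cohIter A f v w n b x - cohSol A f v w b x| ≤ K * κ ^ n := by
  obtain ⟨K, hK, H⟩ := cohIter_succ_sub_le hf hd
  have hκ : 0 < 1 - κ := by linarith [hf.rate_lt_one]
  refine ⟨K / (1 - κ), by positivity, fun n b x hx => ?_⟩
  have h := dist_le_of_le_geometric_of_tendsto κ K hf.rate_lt_one (fun n => ?_)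
    (tendsto_cohIter hf hd b hx) n
  · rw [Real.dist_eq] at h
    exact h.trans (le_of_eq (by ring))
  · rw [Real.dist_eq]
    exact (H n b x hx).trans (mul_le_of_le_one_right
      (mul_nonneg hK (pow_nonneg hf.rate_nonneg n)) (hd.le_one x hx))

theorem cohSol_eq (hf : IsFiberContraction A ω r κ M f f') (hd : IsCohData ω r κ f ϖ v w)
    (b : B) {x : ℝ} (hx : x ∈ Icc 0 r) :
    cohSol A f v w b x = v b x + w b x * cohSol A f v w (A b) (f b x) := by
  have h1 := (tendsto_add_atTop_iff_nat 1).2 (tendsto_cohIter hf hd b hx)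
  exact tendsto_nhds_unique h1
    (((tendsto_cohIter hf hd (A b) (hf.mapsTo b hx)).const_mul _).const_add _)

theorem cohSol_regFam (hf : IsFiberContraction A ω r κ M f f') (hd : IsCohData ω r κ f ϖ v w) :
    RegFam ω (Icc 0 r) (cohSol A f v w) := by
  refine ⟨?_, ?_, ?_⟩
  · obtain ⟨D, hD, H⟩ := cohIter_bdd hf hd
    exact ⟨D, hD, fun b x hx => le_of_tendsto' (tendsto_cohIter hf hd b hx).abs fun n =>
      (H n b x hx).trans (mul_le_of_le_one_right hD (hd.le_one x hx))⟩
  · obtain ⟨P, hP, H⟩ := cohIter_lip hf hd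
    exact ⟨P, hP, fun b x hx y hy => le_of_tendsto' ((tendsto_cohIter hf hd b hx).sub
      (tendsto_cohIter hf hd b hy)).abs fun n => H n b x hx y hy⟩
  · obtain ⟨E, hE, H⟩ := cohIter_hol hf hd
    exact ⟨E, hE, fun b b' x hx => le_of_tendsto' ((tendsto_cohIter hf hd b hx).sub
      (tendsto_cohIter hf hd b' hx)).abs fun n => (H n b b' x hx).trans
      (mul_le_of_le_one_right (mul_nonneg hE (hf.modulus_nonneg b b')) (hd.le_one x hx))⟩

/-- A bounded solution `S` of the formally differentiated equation is the derivative of the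
solution: the derivatives of the approximations converge to `S` uniformly. -/
theorem hasDerivWithinAt_cohSol (hf : IsFiberContraction A ω r κ M f f')
    (hd : IsCohData ω r κ f ϖ v w)
    (hv : ∀ b, ∀ x ∈ Icc 0 r, HasDerivWithinAt (v b) (v' b x) (Icc 0 r) x)
    (hw : ∀ b, ∀ x ∈ Icc 0 r, HasDerivWithinAt (w b) (w' b x) (Icc 0 r) x)
    (hw' : BddFam (Icc 0 r) w') {S : B → ℝ → ℝ} (hS : BddFam (Icc 0 r) S)
    (hSeq : ∀ b, ∀ x ∈ Icc 0 r, S b x = v' b x + w' b x * cohSol A f v w (A b) (f b x)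
      + w b x * f' b x * S (A b) (f b x)) (b : B) {x : ℝ} (hx : x ∈ Icc 0 r) :
    HasDerivWithinAt (cohSol A f v w b) (S b x) (Icc 0 r) x := by
  obtain ⟨K, hK, H⟩ := cohIter_sub_cohSol_le hf hd
  obtain ⟨W, hW, HW⟩ := hw'
  obtain ⟨Q, hQ, HQ⟩ := hS
  -- any rate strictly between `κ` and `1` absorbs the polynomial factor in the convergence of
  -- the derivatives
  obtain ⟨σ, hσ, hσ1⟩ := exists_between hf.rate_lt_one
  let T' : ℕ → B → ℝ → ℝ := fun n => Nat.rec (fun _ _ => 0) (fun n D b x =>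
    v' b x + (w' b x * cohIter A f v w n (A b) (f b x) + w b x * (D (A b) (f b x) * f' b x))) n
  have hT' : ∀ n b, ∀ x ∈ Icc 0 r,
      HasDerivWithinAt (cohIter A f v w n b) (T' n b x) (Icc 0 r) x := by
    intro n
    induction n with
    | zero => exact fun b x hx => hasDerivWithinAt_const x _ 0
    | succ n ih =>
      exact fun b x hx => (hv b x hx).add ((hw b x hx).mul
        ((ih (A b) _ (hf.mapsTo b hx)).comp x (hf.hasDeriv b x hx) (hf.mapsTo b)))
  have hσκ : 0 < σ - κ := by linarith
  set c := Q + W * K / (σ - κ) with hc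
  have hc0 : 0 ≤ c := by positivity
  have hc1 : W * K + κ * c ≤ c * σ := by
    have h1 : W * K = (W * K / (σ - κ)) * (σ - κ) := by field_simp
    have h2 : W * K ≤ c * (σ - κ) := by
      rw [h1]; exact mul_le_mul_of_nonneg_right (by linarith) hσκ.le
    linarith
  have hconv : ∀ n b, ∀ x ∈ Icc 0 r, |T' n b x - S b x| ≤ c * σ ^ n := by
    intro n
    induction n with
    | zero =>
      intro b x hx
      have h1 : |T' 0 b x - S b x| = |S b x| := by simp [T']
      rw [h1, pow_zero, mul_one]
      have : 0 ≤ W * K / (σ - κ) := by positivity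
      linarith [HQ b x hx]
    | succ n ih =>
      intro b x hx
      have h1 : T' (n + 1) b x - S b x = w' b x *
          (cohIter A f v w n (A b) (f b x) - cohSol A f v w (A b) (f b x))
          + w b x * f' b x * (T' n (A b) (f b x) - S (A b) (f b x)) := by
        rw [hSeq b x hx]; simp only [T']; ring
      have hfx := hf.mapsTo b hx
      have h2 : |w b x * f' b x| ≤ κ := by
        rw [abs_mul]
        exact (mul_le_of_le_one_left (abs_nonneg _) (hd.twist_le_one b x hx)).trans
          (hf.deriv_le b x hx)
      have h3 : κ ^ n ≤ σ ^ n := pow_le_pow_left₀ hf.rate_nonneg hσ.le n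
      have hσ0 : 0 ≤ σ ^ n := pow_nonneg (hf.rate_nonneg.trans hσ.le) n
      rw [h1]
      refine (abs_add_le _ _).trans ?_
      rw [abs_mul (w' b x), abs_mul (w b x * f' b x)]
      calc _ ≤ W * (K * σ ^ n) + κ * (c * σ ^ n) := by
            refine add_le_add (mul_le_mul (HW b x hx) ((H n _ _ hfx).trans
              (mul_le_mul_of_nonneg_left h3 hK)) (abs_nonneg _) hW)
              (mul_le_mul h2 (ih _ _ hfx) (abs_nonneg _) hf.rate_nonneg)
        _ = (W * K + κ * c) * σ ^ n := by ring
        _ ≤ c * σ * σ ^ n := mul_le_mul_of_nonneg_right hc1 hσ0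
        _ = _ := by ring
  refine hasDerivWithinAt_of_uniform_limit (convex_Icc 0 r) (fun n => hT' n b)
    (fun y hy => tendsto_cohIter hf hd b hy) ?_ (fun n y hy => hconv n b y hy) hx
  simpa using (tendsto_pow_atTop_nhds_zero_of_lt_one (hf.rate_nonneg.trans hσ.le) hσ1).const_mul c

/-- Solutions of twisted cohomological equations with smooth data are smooth. -/
theorem cohSol_smoothFam (hf : IsFiberContraction A ω r κ M f f')
    (hf' : SmoothFam ω (Icc 0 r) l f') (hd : IsCohData ω r κ f ϖ v w)
    (hv : SmoothFam ω (Icc 0 r) l v) (hw : SmoothFam ω (Icc 0 r) l w) :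
    SmoothFam ω (Icc 0 r) l (cohSol A f v w) := by
  induction l generalizing v w ϖ with
  | zero => exact cohSol_regFam hf hd
  | succ l ih =>
    have hT : SmoothFam ω (Icc 0 r) l (cohSol A f v w) := ih hf'.of_succ hd hv.of_succ hw.of_succ
    have hw1 := hw.of_succ
    obtain ⟨-, v', hvd, hv'⟩ := hv
    obtain ⟨-, w', hwd, hw'⟩ := hw
    have hfl : SmoothFam ω (Icc 0 r) l f :=
      SmoothFam.of_succ ⟨hf.regFam, f', hf.hasDeriv, hf'.of_succ⟩
    have hV : SmoothFam ω (Icc 0 r) l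
        (fun b x => v' b x + w' b x * cohSol A f v w (A b) (f b x)) :=
      hv'.add (hw'.mul ((hT.reindex hf.expansion_nonneg hf.modulus_le).comp hfl hf.mapsTo))
    have hW : SmoothFam ω (Icc 0 r) l (fun b x => w b x * f' b x) := hw1.mul hf'.of_succ
    have hWκ : ∀ b, ∀ x ∈ Icc 0 r, |w b x * f' b x| ≤ κ := fun b x hx => by
      rw [abs_mul]
      exact (mul_le_of_le_one_left (abs_nonneg _) (hd.twist_le_one b x hx)).trans
        (hf.deriv_le b x hx)
    have hd' : IsCohData ω r κ f (fun _ => 1)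
        (fun b x => v' b x + w' b x * cohSol A f v w (A b) (f b x))
        (fun b x => w b x * f' b x) :=
      { self_le := fun x hx => hx.2.trans hf.le_one
        le_one := fun _ _ => le_rfl
        map_le := fun _ _ _ => le_rfl
        twist_le_one := fun b x hx => (hWκ b x hx).trans hf.rate_lt_one.le
        twist_mul_le := fun b x hx => by simpa using hWκ b x hx
        bdd := by simpa only [mul_one, BddFam] using hV.reg.1
        lip := hV.reg.2.1
        hol := by simpa only [mul_one, HolFam] using hV.reg.2.2
        twist_lip := hW.reg.2.1
        twist_hol := hW.reg.2.2 }
    have hS := ih hf'.of_succ hd' hV hW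
    exact ⟨cohSol_regFam hf hd, _, fun b x hx => hasDerivWithinAt_cohSol hf hd hvd hwd hw'.reg.1
      hS.reg.1 (fun b x hx => cohSol_eq hf hd' b hx) b hx, hS⟩

end

section

/-! ### The linearizing chart and its inverse -/

/-- The function with derivative `exp (Y b x)` on `[0,ε]` that vanishes at `0`. Outside `[0,ε]` the
derivative is continued as a constant, which makes the function a diffeomorphism of the line. -/
noncomputable def chart {B : Type*} (ε : ℝ) (Y : B → ℝ → ℝ) (b : B) (x : ℝ) : ℝ :=
  ∫ t in (0 : ℝ)..x, Real.exp (Y b (max 0 (min t ε)))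

/-- The inverse of `chart`. -/
noncomputable def invChart {B : Type*} (ε : ℝ) (Y : B → ℝ → ℝ) (b : B) : ℝ → ℝ :=
  Function.invFun (chart ε Y b)

variable {B : Type*} {A : B → B} {ω : B → B → ℝ} {ε K : ℝ} {Y f f' : B → ℝ → ℝ} {l : ℕ}

theorem clamp_mem (hε : 0 < ε) (x : ℝ) : max 0 (min x ε) ∈ Icc 0 ε :=
  ⟨le_max_left _ _, max_le hε.le (min_le_right _ _)⟩

theorem clamp_eq {x : ℝ} (hx : x ∈ Icc 0 ε) : max 0 (min x ε) = x := by
  rw [min_eq_left hx.2, max_eq_right hx.1]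

theorem RegFam.continuousOn {s : Set ℝ} {v : B → ℝ → ℝ} (hv : RegFam ω s v) (b : B) :
    ContinuousOn (v b) s := by
  obtain ⟨-, ⟨K, hK, H⟩, -⟩ := hv
  exact (LipschitzOnWith.of_dist_le_mul (K := ⟨K, hK⟩) fun x hx y hy => H b x hx y hy).continuousOn

theorem hasDerivAt_chart (hε : 0 < ε) (hc : ∀ b, ContinuousOn (Y b) (Icc 0 ε)) (b : B) (x : ℝ) :
    HasDerivAt (chart ε Y b) (Real.exp (Y b (max 0 (min x ε)))) x := by
  have h : Continuous fun t => Real.exp (Y b (max 0 (min t ε))) :=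
    Real.continuous_exp.comp ((hc b).comp_continuous (by fun_prop) (clamp_mem hε))
  exact intervalIntegral.integral_hasDerivAt_right (h.intervalIntegrable _ _)
    h.stronglyMeasurable.stronglyMeasurableAtFilter h.continuousAt

theorem chart_zero (b : B) : chart ε Y b 0 = 0 := by simp [chart]

theorem le_chart_sub (hε : 0 < ε) (hc : ∀ b, ContinuousOn (Y b) (Icc 0 ε))
    (hK : ∀ b, ∀ x ∈ Icc 0 ε, |Y b x| ≤ K) (b : B) {x y : ℝ} (hxy : x ≤ y) :
    Real.exp (-K) * (y - x) ≤ chart ε Y b y - chart ε Y b x :=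
  mul_sub_le_image_sub_of_le_deriv (fun z => (hasDerivAt_chart hε hc b z).differentiableAt)
    (fun z => by
      rw [(hasDerivAt_chart hε hc b z).deriv]
      exact Real.exp_le_exp.2 (neg_le_of_abs_le (hK b _ (clamp_mem hε z)))) hxy

theorem chart_sub_le (hε : 0 < ε) (hc : ∀ b, ContinuousOn (Y b) (Icc 0 ε))
    (hK : ∀ b, ∀ x ∈ Icc 0 ε, |Y b x| ≤ K) (b : B) {x y : ℝ} (hxy : x ≤ y) :
    chart ε Y b y - chart ε Y b x ≤ Real.exp K * (y - x) :=
  image_sub_le_mul_sub_of_deriv_le (fun z => (hasDerivAt_chart hε hc b z).differentiableAt)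
    (fun z => by
      rw [(hasDerivAt_chart hε hc b z).deriv]
      exact Real.exp_le_exp.2 (le_of_abs_le (hK b _ (clamp_mem hε z)))) hxy

theorem abs_sub_le_chart (hε : 0 < ε) (hc : ∀ b, ContinuousOn (Y b) (Icc 0 ε))
    (hK : ∀ b, ∀ x ∈ Icc 0 ε, |Y b x| ≤ K) (b : B) (x y : ℝ) :
    |x - y| ≤ Real.exp K * |chart ε Y b x - chart ε Y b y| := by
  wlog h : y ≤ x generalizing x y
  · rw [abs_sub_comm x, abs_sub_comm (chart ε Y b x)]
    exact this y x (le_of_not_ge h)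
  have h1 := le_chart_sub hε hc hK b h
  have h2 : Real.exp K * (Real.exp (-K) * (x - y)) = x - y := by
    rw [← mul_assoc, ← Real.exp_add]; simp
  rw [abs_of_nonneg (sub_nonneg.2 h), ← h2]
  exact mul_le_mul_of_nonneg_left (h1.trans (le_abs_self _)) (Real.exp_pos K).le

theorem chart_strictMono (hε : 0 < ε) (hc : ∀ b, ContinuousOn (Y b) (Icc 0 ε)) (b : B) :
    StrictMono (chart ε Y b) :=
  strictMono_of_hasDerivAt_pos (hasDerivAt_chart hε hc b) fun _ => Real.exp_pos _

theorem chart_surjective (hε : 0 < ε) (hc : ∀ b, ContinuousOn (Y b) (Icc 0 ε))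
    (hK : ∀ b, ∀ x ∈ Icc 0 ε, |Y b x| ≤ K) (b : B) : Function.Surjective (chart ε Y b) := by
  have hpos := Real.exp_pos (-K)
  refine Continuous.surjective (continuous_iff_continuousAt.2 fun z =>
    (hasDerivAt_chart hε hc b z).continuousAt) ?_ ?_
  · refine tendsto_atTop_mono' _ ?_ (tendsto_id.const_mul_atTop hpos)
    filter_upwards [eventually_ge_atTop 0] with x hx
    simpa [chart_zero] using le_chart_sub hε hc hK b hx
  · refine tendsto_atBot_mono' _ ?_ (tendsto_id.const_mul_atBot hpos)
    filter_upwards [eventually_le_atBot 0] with x hx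
    simpa [chart_zero] using le_chart_sub hε hc hK b hx

theorem chart_invChart (hε : 0 < ε) (hc : ∀ b, ContinuousOn (Y b) (Icc 0 ε))
    (hK : ∀ b, ∀ x ∈ Icc 0 ε, |Y b x| ≤ K) (b : B) (x : ℝ) : chart ε Y b (invChart ε Y b x) = x :=
  Function.rightInverse_invFun (chart_surjective hε hc hK b) x

theorem invChart_chart (hε : 0 < ε) (hc : ∀ b, ContinuousOn (Y b) (Icc 0 ε)) (b : B) (x : ℝ) :
    invChart ε Y b (chart ε Y b x) = x :=
  Function.leftInverse_invFun (chart_strictMono hε hc b).injective x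

theorem invChart_zero (hε : 0 < ε) (hc : ∀ b, ContinuousOn (Y b) (Icc 0 ε)) (b : B) :
    invChart ε Y b 0 = 0 := by
  simpa [chart_zero] using invChart_chart hε hc b 0

theorem invChart_lipschitz (hε : 0 < ε) (hc : ∀ b, ContinuousOn (Y b) (Icc 0 ε))
    (hK : ∀ b, ∀ x ∈ Icc 0 ε, |Y b x| ≤ K) (b : B) (x y : ℝ) :
    |invChart ε Y b x - invChart ε Y b y| ≤ Real.exp K * |x - y| := by
  simpa [chart_invChart hε hc hK] using
    abs_sub_le_chart hε hc hK b (invChart ε Y b x) (invChart ε Y b y)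

theorem hasDerivAt_invChart (hε : 0 < ε) (hc : ∀ b, ContinuousOn (Y b) (Icc 0 ε))
    (hK : ∀ b, ∀ x ∈ Icc 0 ε, |Y b x| ≤ K) (b : B) (x : ℝ) :
    HasDerivAt (invChart ε Y b) (Real.exp (Y b (max 0 (min (invChart ε Y b x) ε))))⁻¹ x := by
  refine HasDerivAt.of_local_left_inverse ?_ (hasDerivAt_chart hε hc b _) (Real.exp_pos _).ne'
    (Eventually.of_forall (chart_invChart hε hc hK b))
  exact (LipschitzWith.of_dist_le_mul (K := ⟨Real.exp K, (Real.exp_pos K).le⟩)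
    fun x y => invChart_lipschitz hε hc hK b x y).continuous.continuousAt

theorem invChart_nonneg (hε : 0 < ε) (hc : ∀ b, ContinuousOn (Y b) (Icc 0 ε))
    (hK : ∀ b, ∀ x ∈ Icc 0 ε, |Y b x| ≤ K) (b : B) {x : ℝ} (hx : 0 ≤ x) :
    0 ≤ invChart ε Y b x := by
  rw [← (chart_strictMono hε hc b).le_iff_le, chart_invChart hε hc hK, chart_zero]
  exact hx

theorem invChart_mapsTo (hε : 0 < ε) (hc : ∀ b, ContinuousOn (Y b) (Icc 0 ε))
    (hK : ∀ b, ∀ x ∈ Icc 0 ε, |Y b x| ≤ K) (b : B) :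
    MapsTo (invChart ε Y b) (Icc 0 (Real.exp (-K) * ε)) (Icc 0 ε) := by
  intro x hx
  refine ⟨invChart_nonneg hε hc hK b hx.1, ?_⟩
  have h := invChart_lipschitz hε hc hK b x 0
  rw [invChart_zero hε hc, sub_zero, sub_zero, abs_of_nonneg hx.1] at h
  refine (le_abs_self _).trans (h.trans ((mul_le_mul_of_nonneg_left hx.2
    (Real.exp_pos K).le).trans (le_of_eq ?_)))
  rw [← mul_assoc, ← Real.exp_add]; simp

theorem hasDerivWithinAt_invChart (hε : 0 < ε) (hc : ∀ b, ContinuousOn (Y b) (Icc 0 ε))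
    (hK : ∀ b, ∀ x ∈ Icc 0 ε, |Y b x| ≤ K) (b : B) {x : ℝ}
    (hx : x ∈ Icc 0 (Real.exp (-K) * ε)) : HasDerivWithinAt (invChart ε Y b)
      (Real.exp (-Y b (invChart ε Y b x))) (Icc 0 (Real.exp (-K) * ε)) x := by
  have h := hasDerivAt_invChart hε hc hK b x
  rw [clamp_eq (invChart_mapsTo hε hc hK b hx), ← Real.exp_neg] at h
  exact h.hasDerivWithinAt

/-- If the functions `u b` vanish at `0` and their derivatives have modulus `ω` in the parameter,
then the differences `u b - u b'` are of size `ω b b' * x`. -/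
theorem abs_sub_le_mul_of_holFam_deriv {u u' : B → ℝ → ℝ} (h0 : ∀ b, u b 0 = 0)
    (hd : ∀ b, ∀ x ∈ Icc 0 ε, HasDerivWithinAt (u b) (u' b x) (Icc 0 ε) x)
    (h : HolFam ω (Icc 0 ε) u') :
    ∃ K, 0 ≤ K ∧ ∀ b b', ∀ x ∈ Icc 0 ε, |u b x - u b' x| ≤ K * ω b b' * x := by
  obtain ⟨K, hK, H⟩ := h
  refine ⟨K, hK, fun b b' x hx => ?_⟩
  have h1 := (convex_Icc 0 ε).norm_image_sub_le_of_norm_hasDerivWithin_le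
    (f := fun z => u b z - u b' z) (fun z hz => (hd b z hz).sub (hd b' z hz))
    (fun z hz => H b b' z hz) (left_mem_Icc.2 (hx.1.trans hx.2)) hx
  simpa [h0, abs_of_nonneg hx.1] using h1

theorem invChart_regFam (hε : 0 < ε) (hω : ∀ b b', 0 ≤ ω b b') (hY : RegFam ω (Icc 0 ε) Y)
    (hK : ∀ b, ∀ x ∈ Icc 0 ε, |Y b x| ≤ K) :
    RegFam ω (Icc 0 (Real.exp (-K) * ε)) (invChart ε Y) := by
  have hc := hY.continuousOn
  refine ⟨⟨ε, hε.le, fun b x hx => ?_⟩, ⟨Real.exp K, (Real.exp_pos K).le, fun b x _ y _ =>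
    invChart_lipschitz hε hc hK b x y⟩, ?_⟩
  · have h := invChart_mapsTo hε hc hK b hx
    rw [abs_of_nonneg h.1]; exact h.2
  · have hE : SmoothFam ω (Icc 0 ε) 0 Y := hY
    obtain ⟨C, hC, H⟩ := abs_sub_le_mul_of_holFam_deriv (u := chart ε Y)
      (u' := fun b x => Real.exp (Y b x)) (fun b => chart_zero b) (fun b x hx => by
        have h := (hasDerivAt_chart hε hc b x).hasDerivWithinAt (s := Icc 0 ε)
        rwa [clamp_eq hx] at h) hE.exp.reg.2.2
    refine ⟨Real.exp K * (C * ε), by positivity, fun b b' x hx => ?_⟩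
    have hz := invChart_mapsTo hε hc hK b' hx
    -- both sides of `chart b (invChart b x) = x = chart b' (invChart b' x)` are compared with
    -- `chart b (invChart b' x)`
    have h1 := abs_sub_le_chart hε hc hK b (invChart ε Y b x) (invChart ε Y b' x)
    rw [chart_invChart hε hc hK] at h1
    refine h1.trans ?_
    rw [mul_assoc (Real.exp K)]
    refine mul_le_mul_of_nonneg_left ?_ (Real.exp_pos K).le
    have h3 := H b b' _ hz
    rw [chart_invChart hε hc hK, abs_sub_comm] at h3
    refine h3.trans ((mul_le_mul_of_nonneg_left hz.2 (mul_nonneg hC (hω b b'))).trans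
      (le_of_eq (by ring)))

/-- The inverse chart is as smooth as `Y`, by the differential equation
`(invChart b)' = exp (-Y b ∘ invChart b)`. -/
theorem invChart_smoothFam (hε : 0 < ε) (hω : ∀ b b', 0 ≤ ω b b')
    (hY : SmoothFam ω (Icc 0 ε) l Y) (hK : ∀ b, ∀ x ∈ Icc 0 ε, |Y b x| ≤ K) :
    SmoothFam ω (Icc 0 (Real.exp (-K) * ε)) l (invChart ε Y) := by
  have hreg := invChart_regFam hε hω hY.reg hK
  have hc := hY.reg.continuousOn
  induction l with
  | zero => exact hreg
  | succ l ih =>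
    exact ⟨hreg, _, fun b x hx => hasDerivWithinAt_invChart hε hc hK b hx,
      ((hY.of_succ.comp (ih hY.of_succ) (invChart_mapsTo hε hc hK)).neg).exp⟩

/-- If `exp Y` satisfies the derivative of the conjugacy equation then the chart linearizes `f`. -/
theorem chart_comp_eq (hε : 0 < ε) (hc : ∀ b, ContinuousOn (Y b) (Icc 0 ε)) {lam : B → ℝ}
    (hf0 : ∀ b, f b 0 = 0) (hm : ∀ b, MapsTo (f b) (Icc 0 ε) (Icc 0 ε))
    (hd : ∀ b, ∀ x ∈ Icc 0 ε, HasDerivWithinAt (f b) (f' b x) (Icc 0 ε) x)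
    (heq : ∀ b, ∀ x ∈ Icc 0 ε,
      Real.exp (Y (A b) (f b x)) * f' b x = lam b * Real.exp (Y b x)) (b : B) {x : ℝ}
    (hx : x ∈ Icc 0 ε) : chart ε Y (A b) (f b x) = lam b * chart ε Y b x := by
  have h1 := (convex_Icc 0 ε).norm_image_sub_le_of_norm_hasDerivWithin_le (C := 0)
    (f := fun z => chart ε Y (A b) (f b z) - lam b * chart ε Y b z)
    (fun z hz => ((hasDerivAt_chart hε hc (A b) (f b z)).comp_hasDerivWithinAt z (hd b z hz)).sub
      ((hasDerivAt_chart hε hc b z).hasDerivWithinAt.const_mul (lam b)))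
    (fun z hz => by
      rw [clamp_eq hz, clamp_eq (hm b hz), heq b z hz, sub_self, norm_zero])
    (left_mem_Icc.2 hε.le) hx
  simpa [hf0, chart_zero, sub_eq_zero] using h1

theorem map_invChart_eq (hε : 0 < ε) (hc : ∀ b, ContinuousOn (Y b) (Icc 0 ε)) {lam : B → ℝ}
    (hK : ∀ b, ∀ x ∈ Icc 0 ε, |Y b x| ≤ K)
    (hf0 : ∀ b, f b 0 = 0) (hm : ∀ b, MapsTo (f b) (Icc 0 ε) (Icc 0 ε))
    (hd : ∀ b, ∀ x ∈ Icc 0 ε, HasDerivWithinAt (f b) (f' b x) (Icc 0 ε) x)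
    (heq : ∀ b, ∀ x ∈ Icc 0 ε,
      Real.exp (Y (A b) (f b x)) * f' b x = lam b * Real.exp (Y b x)) (b : B) {x : ℝ}
    (hx : x ∈ Icc 0 (Real.exp (-K) * ε)) :
    f b (invChart ε Y b x) = invChart ε Y (A b) (lam b * x) := by
  have h := chart_comp_eq hε hc hf0 hm hd heq b (invChart_mapsTo hε hc hK b hx)
  rw [chart_invChart hε hc hK] at h
  rw [← h, invChart_chart hε hc]

/-! ### The logarithmic derivative of the chart -/

/-- `log (f_b'(x) / f_b'(0))`, the inhomogeneity in the equation for the logarithm of the derivative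
of the linearizing chart. -/
noncomputable def logRatio {B : Type*} (f' : B → ℝ → ℝ) (b : B) (x : ℝ) : ℝ :=
  Real.log (f' b x) - Real.log (f' b 0)

/-- The logarithm of the derivative of the linearizing chart. -/
noncomputable def logDerivChart {B : Type*} (A : B → B) (f f' : B → ℝ → ℝ) : B → ℝ → ℝ :=
  cohSol A f (logRatio f') (fun _ _ => 1)

variable {r c κ M q : ℝ} {f'' : B → ℝ → ℝ}

theorem SmoothFam.logRatio (hr : 0 ≤ r) (hc : 0 < c) (hfc : ∀ b, ∀ x ∈ Icc 0 r, c ≤ f' b x)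
    (hf' : SmoothFam ω (Icc 0 r) l f') : SmoothFam ω (Icc 0 r) l (logRatio f') := by
  have h := hf'.log hc hfc
  exact h.sub (h.comp (smoothFam_const 0) fun _ _ _ => left_mem_Icc.2 hr)

theorem logRatio_isCohData (hf : IsFiberContraction A ω r κ M f f') (hc : 0 < c)
    (hfc : ∀ b, ∀ x ∈ Icc 0 r, c ≤ f' b x) (hf' : RegFam ω (Icc 0 r) f')
    (hd : ∀ b, ∀ x ∈ Icc 0 r, HasDerivWithinAt (f' b) (f'' b x) (Icc 0 r) x)
    (hb : BddFam (Icc 0 r) f'') (hh : HolFam ω (Icc 0 r) f'') :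
    IsCohData ω r κ f (fun x => x) (logRatio f') (fun _ _ => 1) := by
  have hs : SmoothFam ω (Icc 0 r) 0 f' := hf'
  have hv : SmoothFam ω (Icc 0 r) 0 (logRatio f') := hs.logRatio hf.pos.le hc hfc
  have h0 : ∀ b, logRatio f' b 0 = 0 := fun b => sub_self _
  have h1 : SmoothFam ω (Icc 0 r) 0 (fun (_ : B) _ => 1) := smoothFam_const 1
  have hinv := ((hs.log hc hfc).neg).exp.reg
  refine
    { self_le := fun x _ => le_rfl
      le_one := fun x hx => hx.2.trans hf.le_one
      map_le := fun b x hx => (hf.map_le b x hx).trans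
        (mul_le_of_le_one_left hx.1 hf.rate_lt_one.le)
      twist_le_one := fun _ _ _ => by simp
      twist_mul_le := fun b x hx => by simpa using hf.map_le b x hx
      bdd := ?_
      lip := hv.reg.2.1
      hol := ?_
      twist_lip := h1.reg.2.1
      twist_hol := h1.reg.2.2 }
  · obtain ⟨K, hK, H⟩ := hv.reg.2.1
    refine ⟨K, hK, fun b x hx => ?_⟩
    simpa [h0, abs_of_nonneg hx.1] using H b x hx 0 (left_mem_Icc.2 hf.pos.le)
  · refine abs_sub_le_mul_of_holFam_deriv h0 (fun b x hx => ?_)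
      (HolFam.mul hb hh hinv.1 hinv.2.2)
    have hpos := hc.trans_le (hfc b x hx)
    have h := ((hd b x hx).log hpos.ne').sub_const (Real.log (f' b 0))
    exact h.congr_deriv (by simp [Real.exp_neg, Real.exp_log hpos, div_eq_mul_inv])

/-- A solution of the untwisted equation that is smooth near `0` is smooth wherever the orbits are
attracted to `0` at a uniform rate. -/
theorem SmoothFam.of_small_interval {T v : B → ℝ → ℝ} {ε r κ M : ℝ} (hr : 0 < r) (hκ : 0 ≤ κ)
    (hκ1 : κ < 1) (hM : 0 ≤ M) (hA : ∀ b b', ω (A b) (A b') ≤ M * ω b b')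
    (h0 : ∀ b, ∀ x ∈ Icc 0 ε, 0 ≤ f b x) (hle : ∀ b, ∀ x ∈ Icc 0 ε, f b x ≤ κ * x)
    (hf : SmoothFam ω (Icc 0 ε) l f) (hv : SmoothFam ω (Icc 0 ε) l v)
    (hT : ∀ b, ∀ x ∈ Icc 0 ε, T b x = v b x + T (A b) (f b x))
    (h : SmoothFam ω (Icc 0 r) l T) : SmoothFam ω (Icc 0 ε) l T := by
  have key : ∀ n : ℕ, ∀ ρ ≤ ε, 0 ≤ ρ → κ ^ n * ρ ≤ r → SmoothFam ω (Icc 0 ρ) l T := by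
    intro n
    induction n with
    | zero =>
      intro ρ _ _ h1
      exact h.mono (Icc_subset_Icc_right (by simpa using h1))
    | succ n ih =>
      intro ρ hρ hρ0 h1
      have hsub : Icc 0 ρ ⊆ Icc 0 ε := Icc_subset_Icc_right hρ
      have h2 := ih (κ * ρ) ((mul_le_of_le_one_left hρ0 hκ1.le).trans hρ) (by positivity)
        (by rwa [← mul_assoc, ← pow_succ])
      refine ((hv.mono hsub).add ((h2.reindex hM hA).comp (hf.mono hsub) fun b x hx =>
        ⟨h0 b x (hsub hx), (hle b x (hsub hx)).trans (mul_le_mul_of_nonneg_left hx.2 hκ)⟩)).congr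
        fun b x hx => hT b x (hsub hx)
  rcases lt_or_ge ε 0 with hε | hε
  · exact h.mono (by rw [Icc_eq_empty (not_le.2 hε)]; exact empty_subset _)
  · have h1 : Tendsto (fun n : ℕ => κ ^ n * ε) atTop (𝓝 (0 * ε)) :=
      (tendsto_pow_atTop_nhds_zero_of_lt_one hκ hκ1).mul_const ε
    rw [zero_mul] at h1
    obtain ⟨n, hn⟩ := (h1.eventually (gt_mem_nhds hr)).exists
    exact key n ε le_rfl hε hn.le

/-- Fiber maps on `[0,ε]` fixing `0`, with positive derivatives bounded away from `0` and by
`κ < 1`, and with Lipschitz first derivative `f'` and bounded second derivative `f''`. -/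
structure IsUniformGerm {B : Type*} (ε c κ : ℝ) (f f' f'' : B → ℝ → ℝ) : Prop where
  pos : 0 < ε
  le_one : ε ≤ 1
  lower_pos : 0 < c
  rate_nonneg : 0 ≤ κ
  rate_lt_one : κ < 1
  map_zero : ∀ b, f b 0 = 0
  hasDeriv : ∀ b, ∀ x ∈ Icc 0 ε, HasDerivWithinAt (f b) (f' b x) (Icc 0 ε) x
  hasDeriv' : ∀ b, ∀ x ∈ Icc 0 ε, HasDerivWithinAt (f' b) (f'' b x) (Icc 0 ε) x
  lower : ∀ b, ∀ x ∈ Icc 0 ε, c ≤ f' b x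
  upper : ∀ b, ∀ x ∈ Icc 0 ε, f' b x ≤ κ
  lip : LipFam (Icc 0 ε) f'
  bdd : BddFam (Icc 0 ε) f''

namespace IsUniformGerm

theorem map_nonneg (h : IsUniformGerm ε c κ f f' f'') (b : B) {x : ℝ} (hx : x ∈ Icc 0 ε) :
    0 ≤ f b x := by
  have hmono : MonotoneOn (f b) (Icc 0 ε) := by
    refine monotoneOn_of_hasDerivWithinAt_nonneg (convex_Icc 0 ε) (f' := f' b)
      (fun y hy => (h.hasDeriv b y hy).continuousWithinAt)
      (fun y hy => (h.hasDeriv b y (interior_subset hy)).mono interior_subset)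
      (fun y hy => h.lower_pos.le.trans (h.lower b y (interior_subset hy)))
  simpa [h.map_zero] using hmono (left_mem_Icc.2 h.pos.le) hx hx.1

theorem map_le (h : IsUniformGerm ε c κ f f' f'') {r ρ : ℝ} (hr : r ≤ ε) (b : B)
    (hu : ∀ x ∈ Icc 0 r, f' b x ≤ ρ) {x : ℝ} (hx : x ∈ Icc 0 r) : f b x ≤ ρ * x := by
  have hsub : Icc 0 r ⊆ Icc 0 ε := Icc_subset_Icc_right hr
  have h1 := (convex_Icc 0 r).norm_image_sub_le_of_norm_hasDerivWithin_le (C := ρ)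
    (fun y hy => (h.hasDeriv b y (hsub hy)).mono hsub)
    (fun y hy => by
      rw [Real.norm_eq_abs, abs_of_nonneg (h.lower_pos.le.trans (h.lower b y (hsub hy)))]
      exact hu y hy) (left_mem_Icc.2 (hx.1.trans hx.2)) hx
  simpa [h.map_zero, abs_of_nonneg hx.1, abs_of_nonneg (h.map_nonneg b (hsub hx))] using h1

theorem isFiberContraction (h : IsUniformGerm ε c κ f f' f'') {r ρ M : ℝ} (hr0 : 0 < r)
    (hr : r ≤ ε) (hρ : 0 ≤ ρ) (hρ1 : ρ < 1) (hM : 0 ≤ M) (hMρ : M * ρ < 1)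
    (hω : ∀ b b', 0 ≤ ω b b') (hA : ∀ b b', ω (A b) (A b') ≤ M * ω b b')
    (hu : ∀ b, ∀ x ∈ Icc 0 r, f' b x ≤ ρ) (hf' : HolFam ω (Icc 0 ε) f') :
    IsFiberContraction A ω r ρ M f f' := by
  have hsub : Icc 0 r ⊆ Icc 0 ε := Icc_subset_Icc_right hr
  exact
    { pos := hr0
      le_one := hr.trans h.le_one
      modulus_nonneg := hω
      modulus_le := hA
      rate_nonneg := hρ
      rate_lt_one := hρ1
      expansion_nonneg := hM
      expansion_mul_rate_lt_one := hMρ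
      map_nonneg := fun b x hx => h.map_nonneg b (hsub hx)
      map_le := fun b x hx => h.map_le hr b (hu b) hx
      hasDeriv := fun b x hx => (h.hasDeriv b x (hsub hx)).mono hsub
      deriv_le := fun b x hx => by
        rw [abs_of_nonneg (h.lower_pos.le.trans (h.lower b x (hsub hx)))]
        exact hu b x hx
      holder := abs_sub_le_mul_of_holFam_deriv h.map_zero
        (fun b x hx => (h.hasDeriv b x (hsub hx)).mono hsub) (hf'.mono hsub) }

/-- The equation of `logDerivChart` holds on all of `[0,ε]`. Only convergence matters here, so the
constant modulus `1`, which does not see the dependence on the parameter, is used. -/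
theorem logDerivChart_eq (h : IsUniformGerm ε c κ f f' f'') (A : B → B) (b : B) {x : ℝ}
    (hx : x ∈ Icc 0 ε) : logDerivChart A f f' b x
      = logRatio f' b x + logDerivChart A f f' (A b) (f b x) := by
  have hol {u : B → ℝ → ℝ} (hu : BddFam (Icc 0 ε) u) : HolFam (fun _ _ => 1) (Icc 0 ε) u := by
    obtain ⟨K, hK, H⟩ := hu
    refine ⟨K + K, by positivity, fun b b' x hx => ?_⟩
    rw [mul_one]
    exact (abs_sub _ _).trans (add_le_add (H b x hx) (H b' x hx))
  have hb : BddFam (Icc 0 ε) f' := ⟨κ, h.rate_nonneg, fun b x hx => by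
    rw [abs_of_nonneg (h.lower_pos.le.trans (h.lower b x hx))]
    exact h.upper b x hx⟩
  have hf : IsFiberContraction A (fun _ _ => 1) ε κ 1 f f' :=
    h.isFiberContraction h.pos le_rfl h.rate_nonneg h.rate_lt_one zero_le_one
      (by simpa using h.rate_lt_one) (by simp) (by simp) h.upper (hol hb)
  have h1 := cohSol_eq hf (logRatio_isCohData hf h.lower_pos h.lower ⟨hb, h.lip, hol hb⟩
    h.hasDeriv' h.bdd (hol h.bdd)) b hx
  rwa [one_mul] at h1

theorem logDerivChart_zero (h : IsUniformGerm ε c κ f f' f'') (A : B → B) (b : B) :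
    logDerivChart A f f' b 0 = 0 := by
  have h1 : ∀ n b, cohIter A f (logRatio f') (fun _ _ => 1) n b 0 = 0 := by
    intro n
    induction n with
    | zero => exact fun _ => rfl
    | succ n ih => intro b; simp [cohIter, h.map_zero, ih, logRatio]
  simp only [logDerivChart, cohSol, h1]
  exact tendsto_const_nhds.limUnder_eq

/-- If the modulus `ω` expands along `A` by a factor `M` with `M * q < 1`, where `q` bounds the
derivatives *at* `0`, then `logDerivChart` is smooth with modulus `ω` on all of `[0,ε]`. -/
theorem logDerivChart_smoothFam (h : IsUniformGerm ε c κ f f' f'') (hq0 : 0 ≤ q) (hq1 : q < 1)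
    (hq : ∀ b, f' b 0 ≤ q) (hM : 0 < M) (hMq : M * q < 1) (hω : ∀ b b', 0 ≤ ω b b')
    (hA : ∀ b b', ω (A b) (A b') ≤ M * ω b b') (hf' : SmoothFam ω (Icc 0 ε) l f')
    (hf'' : HolFam ω (Icc 0 ε) f'') :
    SmoothFam ω (Icc 0 ε) l (logDerivChart A f f') := by
  obtain ⟨ρ, hρ, hρ'⟩ := exists_between (lt_min hq1 ((lt_inv_mul_iff₀ hM (b := 1)).2 hMq))
  obtain ⟨hρ1, hρM⟩ := lt_min_iff.1 hρ'
  rw [lt_inv_mul_iff₀ hM] at hρM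
  obtain ⟨L, hL, HL⟩ := h.lip
  have hρq : 0 < ρ - q := by linarith
  set r := min ε ((ρ - q) / (L + 1)) with hr
  have hr0 : 0 < r := lt_min h.pos (by positivity)
  have hrε : r ≤ ε := min_le_left _ _
  have hsub : Icc 0 r ⊆ Icc 0 ε := Icc_subset_Icc_right hrε
  have hu : ∀ b, ∀ x ∈ Icc 0 r, f' b x ≤ ρ := by
    intro b x hx
    have h1 := HL b x (hsub hx) 0 (left_mem_Icc.2 h.pos.le)
    rw [sub_zero, abs_of_nonneg hx.1] at h1
    have h2 : (L + 1) * x ≤ ρ - q := by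
      rw [mul_comm, ← le_div_iff₀ (by positivity)]
      exact hx.2.trans (min_le_right _ _)
    linarith [hq b, le_abs_self (f' b x - f' b 0), hx.1]
  have hf : IsFiberContraction A ω r ρ M f f' :=
    h.isFiberContraction hr0 hrε (hq0.trans hρ.le) hρ1 hM.le hρM hω hA hu hf'.reg.2.2
  have hdata := logRatio_isCohData hf h.lower_pos (fun b x hx => h.lower b x (hsub hx))
    (hf'.reg.mono hsub) (fun b x hx => (h.hasDeriv' b x (hsub hx)).mono hsub)
    (h.bdd.mono hsub) (hf''.mono hsub)
  have hsmall : SmoothFam ω (Icc 0 r) l (logDerivChart A f f') :=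
    cohSol_smoothFam hf (hf'.mono hsub) hdata
      ((hf'.mono hsub).logRatio hr0.le h.lower_pos fun b x hx => h.lower b x (hsub hx))
      (smoothFam_const 1)
  have hfreg : RegFam ω (Icc 0 ε) f := by
    refine ⟨⟨κ * ε, mul_nonneg h.rate_nonneg h.pos.le, fun b x hx => ?_⟩,
      ⟨κ, h.rate_nonneg, fun b x hx y hy => ?_⟩, ?_⟩
    · rw [abs_of_nonneg (h.map_nonneg b hx)]
      exact (h.map_le le_rfl b (h.upper b) hx).trans
        (mul_le_mul_of_nonneg_left hx.2 h.rate_nonneg)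
    · refine (convex_Icc 0 ε).norm_image_sub_le_of_norm_hasDerivWithin_le (h.hasDeriv b)
        (fun z hz => ?_) hy hx
      rw [Real.norm_eq_abs, abs_of_nonneg (h.lower_pos.le.trans (h.lower b z hz))]
      exact h.upper b z hz
    · obtain ⟨K, hK, H⟩ := abs_sub_le_mul_of_holFam_deriv h.map_zero h.hasDeriv hf'.reg.2.2
      exact ⟨K, hK, fun b b' x hx => (H b b' x hx).trans (mul_le_of_le_one_right
        (mul_nonneg hK (hω b b')) (hx.2.trans h.le_one))⟩
  have hfs : SmoothFam ω (Icc 0 ε) l f := SmoothFam.of_succ ⟨hfreg, f', h.hasDeriv, hf'⟩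
  exact SmoothFam.of_small_interval hr0 h.rate_nonneg h.rate_lt_one hM.le hA
    (fun b x hx => h.map_nonneg b hx) (fun b x hx => h.map_le le_rfl b (h.upper b) hx) hfs
    (hf'.logRatio h.pos.le h.lower_pos h.lower) (fun b x hx => h.logDerivChart_eq A b hx) hsmall

theorem exp_logDerivChart_mul (h : IsUniformGerm ε c κ f f' f'') (A : B → B) (b : B) {x : ℝ}
    (hx : x ∈ Icc 0 ε) : Real.exp (logDerivChart A f f' (A b) (f b x)) * f' b x
      = f' b 0 * Real.exp (logDerivChart A f f' b x) := by
  have h1 := h.lower_pos.trans_le (h.lower b x hx)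
  have h2 := h.lower_pos.trans_le (h.lower b 0 (left_mem_Icc.2 h.pos.le))
  rw [h.logDerivChart_eq A b hx, Real.exp_add, logRatio, Real.exp_sub, Real.exp_log h1,
    Real.exp_log h2]
  field_simp

end IsUniformGerm

end

section

/-! ### Hölder moduli adapted to a toral endomorphism -/

variable {d : ℕ}

theorem torusMap_sub (A : Matrix (Fin d) (Fin d) ℤ) (b b' : UnitAddTorus (Fin d)) :
    torusMap A (b - b') = torusMap A b - torusMap A b' := by
  ext i
  simp [torusMap, smul_sub]

theorem torusMap_iterate (A : Matrix (Fin d) (Fin d) ℤ) (n : ℕ) (b : UnitAddTorus (Fin d)) :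
    (torusMap A)^[n] b = torusMap (A ^ n) b := by
  induction n with
  | zero =>
    funext i
    simp [torusMap, Matrix.one_apply, ite_smul]
  | succ n ih =>
    rw [Function.iterate_succ_apply', ih, pow_succ']
    funext i
    simp only [torusMap, Matrix.mul_apply, Finset.smul_sum, Finset.sum_smul, smul_smul]
    exact Finset.sum_comm

section

attribute [local instance] Matrix.linftyOpNormedRing Matrix.linftyOpNormedAlgebra

theorem norm_torusMap_le (A : Matrix (Fin d) (Fin d) ℤ) (b : UnitAddTorus (Fin d)) :
    ‖torusMap A b‖ ≤ ‖A.map (Int.cast : ℤ → ℂ)‖ * ‖b‖ := by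
  refine (pi_norm_le_iff_of_nonneg (by positivity)).2 fun i => ?_
  have h1 : ∑ j, ‖(A.map (Int.cast : ℤ → ℂ)) i j‖ ≤ ‖A.map (Int.cast : ℤ → ℂ)‖ := by
    rw [Matrix.linfty_opNorm_def]
    have h := Finset.le_sup (f := fun i => ∑ j, ‖(A.map (Int.cast : ℤ → ℂ)) i j‖₊)
      (Finset.mem_univ i)
    simpa only [NNReal.coe_sum, coe_nnnorm] using NNReal.coe_le_coe.2 h
  refine le_trans ?_ (mul_le_mul_of_nonneg_right h1 (norm_nonneg b))
  rw [Finset.sum_mul]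
  refine (norm_sum_le _ _).trans (Finset.sum_le_sum fun j _ => (norm_zsmul_le _ _).trans ?_)
  refine (mul_le_mul_of_nonneg_left (norm_le_pi_norm b j) (norm_nonneg _)).trans (le_of_eq ?_)
  simp [Int.norm_eq_abs]

/-- The iterates of a toral endomorphism expand at most at any rate larger than the spectral radius,
by Gelfand's formula. -/
theorem exists_norm_torusMap_iterate_le (A : Matrix (Fin d) (Fin d) ℤ) {μ Λ : ℝ}
    (hμ : ∀ z ∈ eigenvalues A, ‖z‖ ≤ μ) (hΛ : 0 < Λ) (hμΛ : μ < Λ) :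
    ∃ K, 0 ≤ K ∧ ∀ n b, ‖(torusMap A)^[n] b‖ ≤ K * Λ ^ n * ‖b‖ := by
  set a : Matrix (Fin d) (Fin d) ℂ := A.map (Int.cast : ℤ → ℂ) with ha
  have hpow (n : ℕ) : (A ^ n).map (Int.cast : ℤ → ℂ) = a ^ n :=
    map_pow (Int.castRingHom ℂ).mapMatrix A n
  have hrad : spectralRadius ℂ a < ENNReal.ofReal Λ := by
    refine lt_of_le_of_lt (iSup₂_le fun z hz => ?_)
      ((ENNReal.ofReal_lt_ofReal_iff hΛ).2 hμΛ)
    have h := ENNReal.ofReal_le_ofReal (hμ z hz)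
    rwa [ofReal_norm] at h
  have hev : ∀ᶠ n : ℕ in atTop, ‖a ^ n‖ / Λ ^ n ≤ 1 := by
    filter_upwards [(spectrum.pow_norm_pow_one_div_tendsto_nhds_spectralRadius a).eventually_lt_const
      hrad, eventually_gt_atTop 0] with n hn hn0
    rw [ENNReal.ofReal_lt_ofReal_iff hΛ] at hn
    rw [div_le_one (by positivity)]
    have h := pow_le_pow_left₀ (by positivity) hn.le n
    rwa [one_div, Real.rpow_inv_natCast_pow (norm_nonneg _) hn0.ne'] at h
  obtain ⟨K, hK⟩ := (isBoundedUnder_of_eventually_le hev).bddAbove_range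
  refine ⟨max K 0, le_max_right _ _, fun n b => ?_⟩
  rw [torusMap_iterate]
  refine (norm_torusMap_le _ b).trans (mul_le_mul_of_nonneg_right ?_ (norm_nonneg b))
  rw [hpow, ← div_le_iff₀ (by positivity)]
  exact (hK (mem_range_self n)).trans (le_max_left _ _)

end

/-- A modulus comparable to `‖b - b'‖ ^ α` that expands exactly by `Λ ^ α` along the map. -/
theorem exists_adapted_modulus (A : Matrix (Fin d) (Fin d) ℤ) {μ Λ α : ℝ}
    (hμ : ∀ z ∈ eigenvalues A, ‖z‖ ≤ μ) (hΛ : 0 < Λ) (hμΛ : μ < Λ) (hα : 0 < α) :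
    ∃ ω : UnitAddTorus (Fin d) → UnitAddTorus (Fin d) → ℝ,
      (∀ b b', ω (torusMap A b) (torusMap A b') ≤ Λ ^ α * ω b b') ∧
      (∀ b b', ‖b - b'‖ ^ α ≤ ω b b') ∧ ∃ K, 0 ≤ K ∧ ∀ b b', ω b b' ≤ K * ‖b - b'‖ ^ α := by
  obtain ⟨K, hK, H⟩ := exists_norm_torusMap_iterate_le A hμ hΛ hμΛ
  set M := Λ ^ α with hM
  have hM0 : 0 < M := Real.rpow_pos_of_pos hΛ α
  have hle : ∀ b b' n, ‖(torusMap A)^[n] (b - b')‖ ^ α / M ^ n ≤ K ^ α * ‖b - b'‖ ^ α := by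
    intro b b' n
    rw [div_le_iff₀ (by positivity)]
    refine (Real.rpow_le_rpow (norm_nonneg _) (H n (b - b')) hα.le).trans (le_of_eq ?_)
    rw [Real.mul_rpow (by positivity) (norm_nonneg _), Real.mul_rpow hK (by positivity), hM,
      ← Real.rpow_natCast, ← Real.rpow_natCast, ← Real.rpow_mul hΛ.le, ← Real.rpow_mul hΛ.le,
      mul_comm (n : ℝ) α]
    ring
  have hbdd : ∀ b b', BddAbove (range fun n => ‖(torusMap A)^[n] (b - b')‖ ^ α / M ^ n) := by
    rintro b b'
    exact ⟨K ^ α * ‖b - b'‖ ^ α, by rintro _ ⟨n, rfl⟩; exact hle b b' n⟩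
  refine ⟨fun b b' => ⨆ n : ℕ, ‖(torusMap A)^[n] (b - b')‖ ^ α / M ^ n, fun b b' => ?_,
    fun b b' => ?_, K ^ α, by positivity, fun b b' => ciSup_le (hle b b')⟩
  · refine ciSup_le fun n => ?_
    have h := mul_le_mul_of_nonneg_left (le_ciSup (hbdd b b') (n + 1)) hM0.le
    refine le_trans (le_of_eq ?_) h
    rw [← torusMap_sub, Function.iterate_succ_apply, pow_succ]
    field_simp
  · simpa using le_ciSup (hbdd b b') 0

theorem norm_torus_le_one (b : UnitAddTorus (Fin d)) : ‖b‖ ≤ 1 :=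
  (pi_norm_le_iff_of_nonneg zero_le_one).2 fun i =>
    (AddCircle.norm_le_half_period 1 one_ne_zero).trans (by norm_num)

/-! ### The fiber maps as a uniform family of germs -/

variable {k : ℕ} {C β : ℝ} {f : UnitAddTorus (Fin d) → ℝ → ℝ}
  {ω : UnitAddTorus (Fin d) → UnitAddTorus (Fin d) → ℝ}

/-- The `j`-th derivatives of the fiber maps, one-sided at the endpoints of `[0,1]`. -/
noncomputable def fiberDeriv (f : UnitAddTorus (Fin d) → ℝ → ℝ) (j : ℕ)
    (b : UnitAddTorus (Fin d)) (x : ℝ) : ℝ :=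
  iteratedDerivWithin j (f b) (Icc 0 1) x

theorem fiberDeriv_zero : fiberDeriv f 0 = f := by
  funext b x
  simp [fiberDeriv]

theorem multiplier_eq (b : UnitAddTorus (Fin d)) : multiplier f b = fiberDeriv f 1 b 0 := by
  simp [multiplier, fiberDeriv, iteratedDerivWithin_one]

theorem hasDerivWithinAt_fiberDeriv (hf : ∀ b, ContDiffOn ℝ k (f b) (Icc 0 1)) {j : ℕ}
    (hj : j < k) (b : UnitAddTorus (Fin d)) {x : ℝ} (hx : x ∈ Icc (0 : ℝ) 1) :
    HasDerivWithinAt (fiberDeriv f j b) (fiberDeriv f (j + 1) b x) (Icc 0 1) x := by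
  have h := ((hf b).differentiableOn_iteratedDerivWithin (m := j) (by exact_mod_cast hj)
    (uniqueDiffOn_Icc one_pos) x hx).hasDerivWithinAt
  rwa [← iteratedDerivWithin_succ] at h

theorem abs_fiberDeriv_sub_le (hf : ∀ b, ContDiffOn ℝ k (f b) (Icc 0 1)) (hC : 0 ≤ C)
    (hH : HolderInBase k 1 C β f) {j : ℕ} (hj : j ≤ k) (b b' : UnitAddTorus (Fin d)) {x : ℝ}
    (hx : x ∈ Icc (0 : ℝ) 1) :
    |fiberDeriv f j b x - fiberDeriv f j b' x| ≤ C * ‖b - b'‖ ^ β := by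
  have h1 : ‖iteratedDerivWithin j (fun x => f b x - f b' x) (Icc 0 1) x‖ₑ
      ≤ ENNReal.ofReal (C * ‖b - b'‖ ^ β) := by
    refine le_trans ?_ (hH b b')
    have hj' : j ∈ Finset.range (k + 1) := Finset.mem_range.2 (Nat.lt_succ_of_le hj)
    exact (le_iSup₂ (f := fun x (_ : x ∈ Icc (0 : ℝ) 1) =>
      ‖iteratedDerivWithin j (fun x => f b x - f b' x) (Icc 0 1) x‖ₑ) x hx).trans
      (le_iSup₂ (f := fun j (_ : j ∈ Finset.range (k + 1)) => ⨆ x ∈ Icc (0 : ℝ) 1,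
        ‖iteratedDerivWithin j (fun x => f b x - f b' x) (Icc 0 1) x‖ₑ) j hj')
  rw [← ofReal_norm, ENNReal.ofReal_le_ofReal_iff (by positivity)] at h1
  have hjk : (j : WithTop ℕ∞) ≤ k := by exact_mod_cast hj
  have h2 : iteratedDerivWithin j (fun x => f b x - f b' x) (Icc 0 1) x
      = fiberDeriv f j b x - fiberDeriv f j b' x :=
    iteratedDerivWithin_sub hx (uniqueDiffOn_Icc one_pos) ((hf b x hx).of_le hjk)
      ((hf b' x hx).of_le hjk)
  rwa [h2] at h1

theorem fiberDeriv_bddFam (hf : ∀ b, ContDiffOn ℝ k (f b) (Icc 0 1)) (hC : 0 ≤ C) (hβ : 0 < β)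
    (hH : HolderInBase k 1 C β f) {j : ℕ} (hj : j ≤ k) : BddFam (Icc 0 1) (fiberDeriv f j) := by
  obtain ⟨K, hK⟩ := isCompact_Icc.exists_bound_of_continuousOn
    ((hf 0).continuousOn_iteratedDerivWithin (m := j) (by exact_mod_cast hj)
      (uniqueDiffOn_Icc one_pos))
  refine ⟨max K 0 + C, by positivity, fun b x hx => ?_⟩
  have h1 := abs_fiberDeriv_sub_le hf hC hH hj b 0 hx
  have h2 : C * ‖b - 0‖ ^ β ≤ C :=
    mul_le_of_le_one_right hC (Real.rpow_le_one (norm_nonneg _) (norm_torus_le_one _) hβ.le)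
  have h3 : |fiberDeriv f j 0 x| ≤ K := hK x hx
  have h4 := abs_add_le (fiberDeriv f j 0 x) (fiberDeriv f j b x - fiberDeriv f j 0 x)
  rw [add_sub_cancel] at h4
  linarith [le_max_left K 0]

theorem fiberDeriv_lipFam (hf : ∀ b, ContDiffOn ℝ k (f b) (Icc 0 1)) (hC : 0 ≤ C) (hβ : 0 < β)
    (hH : HolderInBase k 1 C β f) {j : ℕ} (hj : j < k) : LipFam (Icc 0 1) (fiberDeriv f j) := by
  obtain ⟨K, hK, H⟩ := fiberDeriv_bddFam hf hC hβ hH (Nat.succ_le_of_lt hj)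
  exact ⟨K, hK, fun b x hx y hy => (convex_Icc 0 1).norm_image_sub_le_of_norm_hasDerivWithin_le
    (fun z hz => hasDerivWithinAt_fiberDeriv hf hj b hz) (fun z hz => H b z hz) hy hx⟩

theorem fiberDeriv_holFam (hf : ∀ b, ContDiffOn ℝ k (f b) (Icc 0 1)) (hC : 0 ≤ C)
    (hH : HolderInBase k 1 C β f) (hω : ∀ b b', ‖b - b'‖ ^ β ≤ ω b b') {j : ℕ} (hj : j ≤ k) :
    HolFam ω (Icc 0 1) (fiberDeriv f j) :=
  ⟨C, hC, fun b b' _ hx => (abs_fiberDeriv_sub_le hf hC hH hj b b' hx).trans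
    (mul_le_mul_of_nonneg_left (hω b b') hC)⟩

theorem fiberDeriv_smoothFam (hf : ∀ b, ContDiffOn ℝ k (f b) (Icc 0 1)) (hC : 0 ≤ C) (hβ : 0 < β)
    (hH : HolderInBase k 1 C β f) (hω : ∀ b b', ‖b - b'‖ ^ β ≤ ω b b') {j m : ℕ}
    (hj : j + m + 1 ≤ k) : SmoothFam ω (Icc 0 1) m (fiberDeriv f j) := by
  have hreg {j : ℕ} (hj : j < k) : RegFam ω (Icc 0 1) (fiberDeriv f j) :=
    ⟨fiberDeriv_bddFam hf hC hβ hH hj.le, fiberDeriv_lipFam hf hC hβ hH hj,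
      fiberDeriv_holFam hf hC hH hω hj.le⟩
  induction m generalizing j with
  | zero => exact hreg (by omega)
  | succ m ih =>
    exact ⟨hreg (by omega), _, fun b x hx => hasDerivWithinAt_fiberDeriv hf (by omega) b hx,
      ih (by omega)⟩

theorem multiplier_pos {g : ℝ → ℝ} (hk : k ≠ 0) (hg : IsOrientedDiffeoUnitInterval k g)
    (h0 : g 0 = 0) : 0 < derivWithin g (Icc 0 1) 0 := by
  have h01 : (0 : ℝ) ∈ Icc (0 : ℝ) 1 := by simp
  have hu : UniqueDiffWithinAt ℝ (Icc (0 : ℝ) 1) 0 := uniqueDiffOn_Icc one_pos 0 h01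
  have hk' : (k : WithTop ℕ∞) ≠ 0 := by exact_mod_cast hk
  obtain ⟨g', hg', -, hinv⟩ := hg.exists_inverse
  have hd := (hg.contDiffOn.differentiableOn hk' 0 h01).hasDerivWithinAt
  have hd' : HasDerivWithinAt g' (derivWithin g' (Icc 0 1) 0) (Icc 0 1) (g 0) := by
    rw [h0]
    exact (hg'.differentiableOn hk' 0 h01).hasDerivWithinAt
  have hcomp := (hd'.comp 0 hd hg.mapsTo).congr
    (f₁ := fun x => x) (fun x hx => (hinv.1 hx).symm) (hinv.1 h01).symm
  have h1 := hu.eq_deriv _ hcomp (hasDerivWithinAt_id 0 _)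
  refine lt_of_le_of_ne hg.strictMonoOn.monotoneOn.derivWithin_nonneg fun h => ?_
  rw [← h] at h1
  simp at h1

/-- On a short interval the fiber maps contract uniformly, with derivatives bounded away from
zero. -/
theorem exists_isUniformGerm (hk : 2 ≤ k) (hf : ∀ b, IsOrientedDiffeoUnitInterval k (f b))
    (hf0 : ∀ b, f b 0 = 0) (hC : 0 ≤ C) (hβ : 0 < β) (hH : HolderInBase k 1 C β f) {q : ℝ}
    (hq : q < 1) (hmult : ∀ b, multiplier f b ≤ q) :
    0 < q ∧ ∃ ε c κ, IsUniformGerm ε c κ f (fiberDeriv f 1) (fiberDeriv f 2) := by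
  have hfc := fun b => (hf b).contDiffOn
  have hpos : ∀ b, 0 < fiberDeriv f 1 b 0 := fun b => by
    rw [← multiplier_eq]; exact multiplier_pos (by omega) (hf b) (hf0 b)
  have hle : ∀ b, fiberDeriv f 1 b 0 ≤ q := fun b => by rw [← multiplier_eq]; exact hmult b
  have hcont : Continuous fun b => fiberDeriv f 1 b 0 := by
    refine continuous_iff_continuousAt.2 fun b => ?_
    rw [ContinuousAt, tendsto_iff_norm_sub_tendsto_zero]
    refine squeeze_zero (fun _ => norm_nonneg _)
      (fun b' => abs_fiberDeriv_sub_le hfc hC hH (by omega) b' b (by simp)) ?_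
    have h : Continuous fun b' => C * ‖b' - b‖ ^ β :=
      continuous_const.mul ((continuous_id.sub continuous_const).norm.rpow_const
        fun _ => Or.inr hβ.le)
    simpa [Real.zero_rpow hβ.ne'] using h.tendsto b
  obtain ⟨b₀, -, hb₀⟩ := isCompact_univ.exists_isMinOn univ_nonempty hcont.continuousOn
  have hq0 : 0 < q := (hpos b₀).trans_le (hle b₀)
  refine ⟨hq0, ?_⟩
  set c := fiberDeriv f 1 b₀ 0 with hc
  have hc0 : 0 < c := hpos b₀
  have hcle : ∀ b, c ≤ fiberDeriv f 1 b 0 := fun b => hb₀ (mem_univ b)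
  obtain ⟨L, hL, HL⟩ := fiberDeriv_lipFam hfc hC hβ hH (j := 1) (by omega)
  have hq1 : 0 < 1 - q := by linarith
  set ε := min 1 (min (c / 2 / (L + 1)) ((1 - q) / 2 / (L + 1))) with hε
  have hε0 : 0 < ε := lt_min one_pos (lt_min (by positivity) (by positivity))
  have hε1 : ε ≤ 1 := min_le_left _ _
  have hsub : Icc 0 ε ⊆ Icc 0 1 := Icc_subset_Icc_right hε1
  have hvar : ∀ b, ∀ x ∈ Icc 0 ε, |fiberDeriv f 1 b x - fiberDeriv f 1 b 0| ≤ c / 2 ∧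
      |fiberDeriv f 1 b x - fiberDeriv f 1 b 0| ≤ (1 - q) / 2 := by
    intro b x hx
    have h1 := HL b x (hsub hx) 0 (by simp)
    rw [sub_zero, abs_of_nonneg hx.1] at h1
    have h2 : L * x ≤ (L + 1) * x := mul_le_mul_of_nonneg_right (by linarith) hx.1
    have h3 : (L + 1) * x ≤ c / 2 := by
      rw [mul_comm, ← le_div_iff₀ (by positivity)]
      exact hx.2.trans ((min_le_right _ _).trans (min_le_left _ _))
    have h4 : (L + 1) * x ≤ (1 - q) / 2 := by
      rw [mul_comm, ← le_div_iff₀ (by positivity)]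
      exact hx.2.trans ((min_le_right _ _).trans (min_le_right _ _))
    exact ⟨by linarith, by linarith⟩
  refine ⟨ε, c / 2, (1 + q) / 2,
    { pos := hε0
      le_one := hε1
      lower_pos := by positivity
      rate_nonneg := by positivity
      rate_lt_one := by linarith
      map_zero := hf0
      hasDeriv := fun b x hx => ?_
      hasDeriv' := fun b x hx =>
        (hasDerivWithinAt_fiberDeriv hfc (by omega) b (hsub hx)).mono hsub
      lower := fun b x hx => ?_
      upper := fun b x hx => ?_
      lip := (fiberDeriv_lipFam hfc hC hβ hH (by omega)).mono hsub
      bdd := (fiberDeriv_bddFam hfc hC hβ hH hk).mono hsub }⟩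
  · have h := hasDerivWithinAt_fiberDeriv hfc (j := 0) (by omega) b (hsub hx)
    rw [fiberDeriv_zero] at h
    exact h.mono hsub
  · have h := neg_le_of_abs_le (hvar b x hx).1
    linarith [hcle b]
  · have h := le_of_abs_le (hvar b x hx).2
    linarith [hle b]

/-- For every exponent `α` with `Λ ^ α * q < 1` the logarithmic derivative of the chart is
`α`-Hölder in the base point, on an interval that does not depend on `α`. -/
theorem exists_modulus_logDerivChart (A : Matrix (Fin d) (Fin d) ℤ) (hk : 2 ≤ k)
    (hf : ∀ b, ContDiffOn ℝ k (f b) (Icc 0 1)) (hC : 0 ≤ C) (hβ : 0 < β)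
    (hH : HolderInBase k 1 C β f) {q ε c κ μ Λ α : ℝ} (hq0 : 0 < q) (hq : q < 1)
    (hmult : ∀ b, multiplier f b ≤ q)
    (hg : IsUniformGerm ε c κ f (fiberDeriv f 1) (fiberDeriv f 2))
    (hμ : ∀ z ∈ eigenvalues A, ‖z‖ ≤ μ) (hΛ : 0 < Λ) (hμΛ : μ < Λ) (hα : 0 < α) (hαβ : α ≤ β)
    (hΛq : Λ ^ α * q < 1) :
    ∃ ω : UnitAddTorus (Fin d) → UnitAddTorus (Fin d) → ℝ, (∀ b b', 0 ≤ ω b b') ∧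
      (∃ K, 0 ≤ K ∧ ∀ b b', ω b b' ≤ K * ‖b - b'‖ ^ α) ∧
      SmoothFam ω (Icc 0 ε) (k - 2) (logDerivChart (torusMap A) f (fiberDeriv f 1)) := by
  obtain ⟨ω, hωA, hωle, hωK⟩ := exists_adapted_modulus A hμ hΛ hμΛ hα
  have hω0 : ∀ b b', 0 ≤ ω b b' := fun b b' =>
    (Real.rpow_nonneg (norm_nonneg _) α).trans (hωle b b')
  have hωβ : ∀ b b', ‖b - b'‖ ^ β ≤ ω b b' := fun b b' =>
    (Real.rpow_le_rpow_of_exponent_ge' (norm_nonneg _) (norm_torus_le_one _) hα.le hαβ).trans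
      (hωle b b')
  have hsub : Icc 0 ε ⊆ Icc 0 1 := Icc_subset_Icc_right hg.le_one
  exact ⟨ω, hω0, hωK, hg.logDerivChart_smoothFam hq0.le hq
    (fun b => by rw [← multiplier_eq]; exact hmult b) (Real.rpow_pos_of_pos hΛ α) hΛq hω0 hωA
    ((fiberDeriv_smoothFam hf hC hβ hH hωβ (by omega)).mono hsub)
    ((fiberDeriv_holFam hf hC hH hωβ hk).mono hsub)⟩

theorem exists_rpow_mul_lt_one {μ q β : ℝ} (hq : q < 1) (hμ : 0 < μ) (hβ : 0 < β) :
    ∃ α, 0 < α ∧ α ≤ β ∧ μ ^ α * q < 1 := by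
  have h1 : Tendsto (fun α : ℝ => μ ^ α * q) (𝓝[>] 0) (𝓝 (μ ^ (0 : ℝ) * q)) :=
    ((Real.continuous_const_rpow hμ.ne').tendsto 0).mul_const q |>.mono_left nhdsWithin_le_nhds
  rw [Real.rpow_zero, one_mul] at h1
  obtain ⟨α, h2, h3⟩ := ((h1.eventually (gt_mem_nhds hq)).and
    (Ioc_mem_nhdsGT hβ)).exists
  exact ⟨α, h3.1, h3.2, h2⟩

theorem exists_gt_rpow_mul_lt_one {μ q α : ℝ} (hq0 : 0 < q) (hq : q < 1) (hμ : 0 ≤ μ) (hα : 0 < α)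
    (h : α < Real.logb μ q⁻¹) : ∃ Λ, μ < Λ ∧ Λ ^ α * q < 1 := by
  have hlog : 0 < Real.log q⁻¹ := Real.log_pos (one_lt_inv_iff₀.2 ⟨hq0, hq⟩)
  -- positivity of the quotient `log q⁻¹ / log μ` already forces `μ > 1`
  have hμ1 : 1 < μ := by
    refine (Real.log_pos_iff hμ).1 ?_
    have h1 : 0 < Real.log q⁻¹ / Real.log μ := hα.trans h
    exact (div_pos_iff_of_pos_left hlog).1 h1
  have h1 : μ ^ α * q < 1 := by
    rw [← lt_div_iff₀ hq0, one_div]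
    exact (Real.lt_logb_iff_rpow_lt hμ1 (by positivity)).1 h
  have h2 : Tendsto (fun Λ : ℝ => Λ ^ α * q) (𝓝[>] μ) (𝓝 (μ ^ α * q)) :=
    ((Real.continuous_rpow_const hα.le).tendsto μ).mul_const q |>.mono_left nhdsWithin_le_nhds
  obtain ⟨Λ, h3, h4⟩ := ((h2.eventually (gt_mem_nhds h1)).and self_mem_nhdsWithin).exists
  exact ⟨Λ, h4, h3⟩

end

section

/-! ### The linearizing homeomorphism -/

/-- Joint continuity of a family that is Lipschitz in the variable and Hölder in the base point. -/
theorem RegFam.continuousOn_uncurry {d : ℕ} {ω : UnitAddTorus (Fin d) → UnitAddTorus (Fin d) → ℝ}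
    {v : UnitAddTorus (Fin d) → ℝ → ℝ} {K α r : ℝ} (hα : 0 < α)
    (hω : ∀ b b', ω b b' ≤ K * ‖b - b'‖ ^ α) (hv : RegFam ω (Icc 0 r) v) :
    ContinuousOn (fun p : UnitAddTorus (Fin d) × ℝ => v p.1 p.2) (strip d r) := by
  obtain ⟨-, ⟨P, hP, HP⟩, ⟨Q, hQ, HQ⟩⟩ := hv
  rintro ⟨b₀, x₀⟩ ⟨-, hx₀⟩
  rw [ContinuousWithinAt, tendsto_iff_norm_sub_tendsto_zero]
  have hcont : Continuous fun p : UnitAddTorus (Fin d) × ℝ =>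
      Q * (K * ‖p.1 - b₀‖ ^ α) + P * |p.2 - x₀| := by
    refine Continuous.add (continuous_const.mul (continuous_const.mul
      ((continuous_fst.sub continuous_const).norm.rpow_const fun _ => Or.inr hα.le))) ?_
    fun_prop
  have hlim := (hcont.tendsto (b₀, x₀)).mono_left
    (nhdsWithin_le_nhds (s := strip d r))
  simp only [sub_self, norm_zero, Real.zero_rpow hα.ne', mul_zero, abs_zero, add_zero] at hlim
  refine squeeze_zero' (Eventually.of_forall fun _ => norm_nonneg _) ?_ hlim
  filter_upwards [self_mem_nhdsWithin] with p hp
  refine (abs_sub_le _ (v b₀ p.2) _).trans (add_le_add ?_ (HP b₀ _ hp.2 _ hx₀))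
  exact (HQ p.1 b₀ _ hp.2).trans (mul_le_mul_of_nonneg_left (hω _ _) hQ)

theorem isEmbedding_fiberShift {d : ℕ} {r : ℝ} {h : UnitAddTorus (Fin d) → ℝ → ℝ}
    (hc : ContinuousOn (fun p : UnitAddTorus (Fin d) × ℝ => h p.1 p.2) (strip d r))
    (hinj : ∀ b, InjOn (fun x => x + h b x) (Icc 0 r)) :
    Topology.IsEmbedding ((strip d r).domRestrict (fiberShift h)) := by
  have hcomp : IsCompact (strip d r) := isCompact_univ.prod isCompact_Icc
  have : CompactSpace (strip d r) := isCompact_iff_compactSpace.1 hcomp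
  have hcont : ContinuousOn (fiberShift h) (strip d r) :=
    continuousOn_fst.prodMk (continuousOn_snd.add hc)
  refine (Continuous.isClosedEmbedding (continuousOn_iff_continuous_domRestrict.1 hcont)
    ?_).isEmbedding
  rintro ⟨⟨b, x⟩, hx⟩ ⟨⟨b', x'⟩, hx'⟩ heq
  have heq' : (b, x + h b x) = (b', x' + h b' x') := heq
  obtain ⟨rfl, h2⟩ := Prod.mk.inj heq'
  have h3 : x = x' := hinj b hx.2 hx'.2 h2
  subst h3
  rfl

end

end HolderSkew

open HolderSkew
theorem theorem3 (d : ℕ) (A : Matrix (Fin d) (Fin d) ℤ) (hA : IsHyperbolicAutomorphism A)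
    (μ : ℝ) (hμ : IsGreatest ((fun z : ℂ => ‖z‖) '' HolderSkew.eigenvalues A) μ)
    (k : ℕ) (hk : 2 ≤ k)
    (f : UnitAddTorus (Fin d) → ℝ → ℝ)
    (hf : ∀ b, IsOrientedDiffeoUnitInterval k (f b))
    (hf0 : ∀ b, f b 0 = 0) (hf1 : ∀ b, f b 1 = 1)
    (C β : ℝ) (hC : 0 < C) (hβ : 0 < β) (hHolder : HolderInBase k 1 C β f)
    (q : ℝ) (hq : q < 1) (hmult : ∀ b, multiplier f b ≤ q) :
    ∃ ε : ℝ, 0 < ε ∧ ε ≤ 1 ∧ ∃ h : UnitAddTorus (Fin d) → ℝ → ℝ,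
      -- normalization of the fiber maps at zero
      (∀ b, h b 0 = 0 ∧ HasDerivWithinAt (h b) 0 (Icc 0 ε) 0) ∧
      -- `H` is a homeomorphism from `𝕋^d × [0,ε]` onto a neighborhood of `𝕋^d × {0}` in `M`
      MapsTo (fiberShift h) (strip d ε) (strip d 1) ∧
      Topology.IsEmbedding ((strip d ε).domRestrict (fiberShift h)) ∧
      (∃ δ : ℝ, 0 < δ ∧ strip d δ ⊆ fiberShift h '' strip d ε) ∧
      -- `F ∘ H = H ∘ F₀` on `𝕋^d × [0,ε]`
      EqOn (skewProduct A f ∘ fiberShift h) (fiberShift h ∘ linearization A f) (strip d ε) ∧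
      -- fiberwise smoothness
      (∀ b, ContDiffOn ℝ ((k - 2 : ℕ) : ℕ∞) (h b) (Icc 0 ε)) ∧
      -- Hölder continuity in the base, for every admissible exponent
      (∀ α : ℝ, 0 < α → α ≤ β → α < Real.logb μ q⁻¹ → ∀ l : ℕ, l ≤ k - 2 →
        ∃ C' : ℝ, 0 < C' ∧ HolderInBase l ε C' α h) := by
  obtain ⟨hq0, r, c, κ, hg⟩ := exists_isUniformGerm hk hf hf0 hC.le hβ hHolder hq hmult
  have hfc := fun b => (hf b).contDiffOn
  have hev : ∀ z ∈ HolderSkew.eigenvalues A, ‖z‖ ≤ μ := fun z hz => hμ.2 ⟨z, hz, rfl⟩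
  have hμ0 : 0 ≤ μ := by
    obtain ⟨z, -, hz⟩ := hμ.1
    exact hz ▸ norm_nonneg z
  set Y := logDerivChart (torusMap A) f (fiberDeriv f 1) with hYdef
  have hmod : ∀ {α Λ : ℝ}, 0 < α → α ≤ β → μ < Λ → Λ ^ α * q < 1 →
      ∃ ω : UnitAddTorus (Fin d) → UnitAddTorus (Fin d) → ℝ, (∀ b b', 0 ≤ ω b b') ∧
        (∃ K, 0 ≤ K ∧ ∀ b b', ω b b' ≤ K * ‖b - b'‖ ^ α) ∧ SmoothFam ω (Icc 0 r) (k - 2) Y :=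
    fun hα hαβ hΛ hΛq => exists_modulus_logDerivChart A hk hfc hC.le hβ hHolder hq0 hq hmult hg hev
      (hμ0.trans_lt hΛ) hΛ hα hαβ hΛq
  -- some small exponent is always admissible; it gives the continuity of the chart
  obtain ⟨α₀, hα₀, hα₀β, hα₀q⟩ := exists_rpow_mul_lt_one hq (show 0 < μ + 1 by linarith) hβ
  obtain ⟨ω₀, hω₀, ⟨K₀, hK₀, hωK₀⟩, hY₀⟩ := hmod hα₀ hα₀β (lt_add_one μ) hα₀q
  obtain ⟨K, hK, hYK⟩ := hY₀.reg.1
  have hYc := hY₀.reg.continuousOn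
  have hr := hg.pos
  set ε := Real.exp (-K) * r with hε
  have hε0 : 0 < ε := mul_pos (Real.exp_pos _) hr
  have hεr : ε ≤ r := mul_le_of_le_one_left hr.le (Real.exp_le_one_iff.2 (by linarith))
  have hε1 : ε ≤ 1 := hεr.trans hg.le_one
  have hid : ∃ K : ℝ, ∀ x ∈ Icc 0 ε, |x| ≤ K :=
    ⟨ε, fun x hx => by rw [abs_of_nonneg hx.1]; exact hx.2⟩
  set h : UnitAddTorus (Fin d) → ℝ → ℝ := fun b x => invChart r Y b x - x with hh
  have hshift : ∀ b x, x + h b x = invChart r Y b x := fun b x => by simp [hh]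
  have hsmooth : ∀ {ω : UnitAddTorus (Fin d) → UnitAddTorus (Fin d) → ℝ}, (∀ b b', 0 ≤ ω b b') →
      SmoothFam ω (Icc 0 r) (k - 2) Y → SmoothFam ω (Icc 0 ε) (k - 2) h :=
    fun hω hY => (invChart_smoothFam hr hω hY hYK).sub (smoothFam_id hid)
  have hm := invChart_mapsTo hr hYc hYK
  refine ⟨ε, hε0, hε1, h, fun b => ⟨?_, ?_⟩, ?_, ?_, ?_, ?_, ?_, ?_⟩
  · simp [hh, invChart_zero hr hYc]
  · have h1 := (hasDerivWithinAt_invChart hr hYc hYK b (left_mem_Icc.2 hε0.le)).sub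
      (hasDerivWithinAt_id 0 _)
    rw [invChart_zero hr hYc, hYdef, hg.logDerivChart_zero] at h1
    exact h1.congr_deriv (by simp)
  · rintro ⟨b, x⟩ ⟨-, hx⟩
    refine ⟨mem_univ _, ?_⟩
    simp only [fiberShift, hshift]
    exact Icc_subset_Icc_right hg.le_one (hm b hx)
  · refine isEmbedding_fiberShift
      ((hsmooth hω₀ hY₀).reg.continuousOn_uncurry hα₀ hωK₀) fun b => ?_
    simp only [hshift]
    exact (Function.LeftInverse.injective (chart_invChart hr hYc hYK b)).injOn
  · refine ⟨Real.exp (-K) * ε, by positivity, ?_⟩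
    rintro ⟨b, y⟩ ⟨-, hy⟩
    refine ⟨(b, chart r Y b y), ⟨mem_univ _, ?_, ?_⟩, ?_⟩
    · simpa [chart_zero] using (chart_strictMono hr hYc b).monotone hy.1
    · have h1 := chart_sub_le hr hYc hYK b hy.1
      rw [chart_zero, sub_zero, sub_zero] at h1
      refine h1.trans ((mul_le_mul_of_nonneg_left hy.2 (Real.exp_pos K).le).trans (le_of_eq ?_))
      rw [← mul_assoc, ← Real.exp_add]
      simp
    · simp [fiberShift, hshift, invChart_chart hr hYc]
  · rintro ⟨b, x⟩ ⟨-, hx⟩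
    have h1 := map_invChart_eq (A := torusMap A) hr hYc (lam := fun b => fiberDeriv f 1 b 0) hYK
      hf0 (fun b x hx => ⟨hg.map_nonneg b hx, (hg.map_le le_rfl b (hg.upper b) hx).trans
        ((mul_le_of_le_one_left hx.1 hg.rate_lt_one.le).trans hx.2)⟩) hg.hasDeriv
      (fun b x hx => hg.exp_logDerivChart_mul (torusMap A) b hx) b hx
    simp only [Function.comp, skewProduct, linearization, fiberShift, hshift, multiplier_eq]
    rw [h1]
  · exact fun b => (hsmooth hω₀ hY₀).contDiffOn hε0 b
  · intro α hα hαβ hαlog l hl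
    obtain ⟨Λ, hΛ, hΛq⟩ := exists_gt_rpow_mul_lt_one hq0 hq hμ0 hα hαlog
    obtain ⟨ω, hω, ⟨K₁, hK₁, hωK₁⟩, hY⟩ := hmod hα hαβ hΛ hΛq
    obtain ⟨K₂, hK₂, H⟩ := ((hsmooth hω hY).of_le hl).eCNorm_sub_le hω hε0
    refine ⟨K₂ * K₁ + 1, by positivity, fun b b' => (H b b').trans (ENNReal.ofReal_le_ofReal ?_)⟩
    have h1 := mul_le_mul_of_nonneg_left (hωK₁ b b') hK₂
    have h2 : 0 ≤ ‖b - b'‖ ^ α := by positivity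
    linarith
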